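/- Let $M\ge 0$, $\beta\in\mathbb C$ and $w_1,\dots,w_M\in\mathbb C\setminus\{0\}$. Consider $M$ sites, each carrying $\mathbb C^2$ with basis $|0\rangle,|1\rangle$, and an auxiliary space $W_a=\mathbb C^2$. Let $$\mathcal L_{aj}(v)=\begin{pmatrix}1-\beta v&0&0&0\\0&1+\beta v&2v&0\\0&1&v&0\\0&0&0&v\end{pmatrix}$$ act on $W_a\otimes\mathbb C^2_j$ in the basis $|0\rangle_a|0\rangle_j,|0\rangle_a|1\rangle_j,|1\rangle_a|0\rangle_j,|1\rangle_a|1\rangle_j$ (the six-vertex model at $t=-1$). Put $\mathcal T_a(v)=\mathcal L_{aM}(v/w_1)\cdots\mathcal L_{a2}(v/w_{M-1})\mathcal L_{a1}(v/w_M)$ (site $1$ acts first; site $j$ carries $w_{M+1-j}$), $\mathcal B(v)={}_a\langle 0|\mathcal T_a(v)|1\rangle_a$, $\mathcal C(v)={}_a\langle 1|\mathcal T_a(v)|0\rangle_a$, $a(v)=\prod_{j=1}^M(1-\beta v/w_j)$, $d(v)=\prod_{j=1}^M v/w_j$. For $u\in\mathbb C^N$, $v\in\mathbb C^N$ let $|\Psi(\{v\}_N)\rangle=\mathcal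 B(v_1)\cdots\mathcal B(v_N)|0^M\rangle$ and $\langle\Psi(\{u\}_N)|=\langle 0^M|\mathcal C(u_1)\cdots\mathcal C(u_N)$, and for $0\le n\le N$, $N-n\le M$, $u\in\mathbb C^n$, let $$S(\{u\}_n|\{v\}_N|\{w\})=\langle 1^{N-n}0^{M-N+n}|\prod_{j=1}^n\mathcal C(u_j)\prod_{k=1}^N\mathcal B(v_k)|0^M\rangle .$$ Below, a formula is asserted as an equality at all parameters where none of its denominators vanishes; at the remaining parameters (with all $w_j\neq0$) the left-hand side is the limit of the right-hand side along parameters of the first kind. The limit is taken in $(u,v)$ with $\beta,w$ fixed in (1) and (2), and in $(\beta,u,v,w)$ in (3). No Bethe equations are imposed. (1) Homogeneous case. If $w_1=\dots=w_M=1$, so that $a(v)=(1-\beta v)^M$ and $d(v)=v^M$, then $$\langle\Psi(\{u\}_N)|\Psi(\{v\}_N)\rangle=\prod_{j=1}^N(2v_j)\prod_{1\le j<k\le N}\frac{(u_j+u_k)(v_j+v_k)}{(u_j-u_k)(v_k-v_j)}\det_{1\le j,k\le N}\left[\frac{a(u_j)d(v_k)-d(u_j)a(v_k)}{v_k-u_j}\right].$$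 (2) Inhomogeneous case. The same formula holds for arbitrary nonzero $w_1,\dots,w_M$. (3) Intermediate scalar products. For $0\le n\le N$ with $N-n\le M$, $$S(\{u\}_n|\{v\}_N|\{w\})=\prod_{j=1}^N(2v_j)\prod_{1\le j<k\le N}\frac{v_j+v_k}{v_k-v_j}\prod_{M-N+n+1\le j<k\le M}\frac1{\beta(1-w_k/w_j)}\prod_{1\le j<k\le n}\frac{u_j+u_k}{u_j-u_k}\ \det_N Q,$$ where for $1\le j\le n$ $$Q_{jk}=\prod_{l=M-N+n+1}^M\frac{\beta u_j+w_l}{\beta u_j-w_l}\cdot\frac{a(u_j)d(v_k)-a(v_k)d(u_j)}{v_k-u_j},$$ and for $n+1\le j\le N$ $$Q_{jk}=\frac1{w_{M-N+j}}\prod_{l\ne M-N+j}\Bigl(1-\frac{\beta v_k}{w_l}\Bigr).$$ -/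

import Mathlib

open Filter Topology Matrix

namespace SixVertex

/-- Occupation configurations of `M` sites: they label the orthonormal basis
`|n_1⟩_1 ⊗ ⋯ ⊗ |n_M⟩_M` of `(ℂ²)^{⊗ M}`. Site `j` of the literature (`1 ≤ j ≤ M`) is the element
`j - 1` of `Fin M`. -/
abbrev Config (M : ℕ) : Type := Fin M → Fin 2

/-- Operators on `(ℂ²)^{⊗ M}`, as matrices `⟨m| X |n⟩` in the occupation basis. -/
abbrev QOp (M : ℕ) : Type := Matrix (Config M) (Config M) ℂ

/-- The `L`-operator of the six-vertex model at `t = -1`, as a `2 × 2` matrix in the auxiliary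
space whose entries are operators on the two-dimensional space of one site. -/
noncomputable def lOperator (β v : ℂ) : Matrix (Fin 2) (Fin 2) (Matrix (Fin 2) (Fin 2) ℂ) :=
  !![!![1 - β * v, 0; 0, 1 + β * v], !![0, 0; 2 * v, 0];
     !![0, 1; 0, 0], !![v, 0; 0, v]]

/-- The operator acting as `X` at site `j` and as the identity at all other sites. -/
def siteOp {M : ℕ} (j : Fin M) (X : Matrix (Fin 2) (Fin 2) ℂ) : QOp M :=
  fun m n => if ∀ i, i ≠ j → m i = n i then X (m j) (n j) else 0

/-- The inhomogeneous monodromy matrix `L_{aM}(v / w_1) ⋯ L_{a2}(v / w_{M-1}) L_{a1}(v / w_M)`: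
the factor of site `1` acts first, and site `j` carries the parameter `w_{M+1-j}`. -/
noncomputable def monodromy {M : ℕ} (β : ℂ) (w : Fin M → ℂ) (v : ℂ) :
    Matrix (Fin 2) (Fin 2) (QOp M) :=
  (List.ofFn fun j : Fin M => (lOperator β (v / w j.rev)).map (siteOp j)).reverse.prod

/-- The operator `𝓑(v, {w}) = ₐ⟨0| T_a(v, {w}) |1⟩ₐ`. -/
noncomputable def opB {M : ℕ} (β : ℂ) (w : Fin M → ℂ) (v : ℂ) : QOp M := monodromy β w v 0 1

/-- The operator `𝓒(v, {w}) = ₐ⟨1| T_a(v, {w}) |0⟩ₐ`. -/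
noncomputable def opC {M : ℕ} (β : ℂ) (w : Fin M → ℂ) (v : ℂ) : QOp M := monodromy β w v 1 0

/-- The coordinate (row or column) vector of a basis state. -/
noncomputable def basisVec {M : ℕ} (c : Config M) : Config M → ℂ := Pi.single c 1

/-- The off-shell state `|Ψ({v}_N, {w})⟩ = 𝓑(v_1) ⋯ 𝓑(v_N) |0^M⟩`. -/
noncomputable def ketPsi {M N : ℕ} (β : ℂ) (w : Fin M → ℂ) (v : Fin N → ℂ) : Config M → ℂ :=
  (List.ofFn fun k => opB β w (v k)).prod *ᵥ basisVec (fun _ => 0)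

/-- The row vector `⟨c| 𝓒(u_1) ⋯ 𝓒(u_n)`. -/
noncomputable def braFrom {M n : ℕ} (c : Config M) (β : ℂ) (w : Fin M → ℂ) (u : Fin n → ℂ) :
    Config M → ℂ :=
  basisVec c ᵥ* (List.ofFn fun j => opC β w (u j)).prod

/-- The dual off-shell state `⟨Ψ({u}_N, {w})| = ⟨0^M| 𝓒(u_1) ⋯ 𝓒(u_N)`. -/
noncomputable def braPsi {M N : ℕ} (β : ℂ) (w : Fin M → ℂ) (u : Fin N → ℂ) : Config M → ℂ :=
  braFrom (fun _ => 0) β w u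

/-- The scalar product `⟨Ψ({u}_N, {w}) | Ψ({v}_N, {w})⟩`. -/
noncomputable def scalarProduct {M N : ℕ} (β : ℂ) (w : Fin M → ℂ) (u v : Fin N → ℂ) : ℂ :=
  braPsi β w u ⬝ᵥ ketPsi β w v

/-- The intermediate scalar product
`S({u}_n | {v}_N | {w}) = ⟨1^{N-n} 0^{M-N+n}| 𝓒(u_1) ⋯ 𝓒(u_n) 𝓑(v_1) ⋯ 𝓑(v_N) |0^M⟩`.
The sizes `n ≤ N`, `N - n ≤ M` are written as `m = N - n` and `r = M - N + n`,
so that `N = n + m` and `M = r + m`. -/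
noncomputable def intermediate {n m r : ℕ} (β : ℂ) (u : Fin n → ℂ) (v : Fin (n + m) → ℂ)
    (w : Fin (r + m) → ℂ) : ℂ :=
  braFrom (fun i : Fin (r + m) => if i.val < m then 1 else 0) β w u ⬝ᵥ ketPsi β w v

/-- `a(v, {w}) = ∏_j (1 - β v / w_j)`. -/
noncomputable def aFun {M : ℕ} (β : ℂ) (w : Fin M → ℂ) (v : ℂ) : ℂ := ∏ j, (1 - β * v / w j)

/-- `d(v, {w}) = ∏_j v / w_j`. -/
noncomputable def dFun {M : ℕ} (w : Fin M → ℂ) (v : ℂ) : ℂ := ∏ j, v / w j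

/-- The determinant expression for the scalar product, for given functions `a` and `d`. -/
noncomputable def detFormula {N : ℕ} (a d : ℂ → ℂ) (u v : Fin N → ℂ) : ℂ :=
  (∏ j, 2 * v j) *
    (∏ j, ∏ k ∈ Finset.Ioi j, (u j + u k) * (v j + v k) / ((u j - u k) * (v k - v j))) *
    Matrix.det (Matrix.of fun j k : Fin N =>
      (a (u j) * d (v k) - d (u j) * a (v k)) / (v k - u j))

/-- The points at which no denominator of `detFormula` vanishes. -/
def genericUV (N : ℕ) : Set ((Fin N → ℂ) × (Fin N → ℂ)) :=
  {p | Function.Injective p.1 ∧ Function.Injective p.2 ∧ ∀ j k, p.1 j ≠ p.2 k}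

/-- The `N × N` matrix of the determinant formula for the intermediate scalar product
(`N = n + m`, `M = r + m`); the last `m` inhomogeneities `w_{M-N+n+1}, …, w_M` are the
`w (Fin.natAdd r l)` with `l : Fin m`. -/
noncomputable def intermediateMatrix {n m r : ℕ} (β : ℂ) (u : Fin n → ℂ) (v : Fin (n + m) → ℂ)
    (w : Fin (r + m) → ℂ) : Matrix (Fin (n + m)) (Fin (n + m)) ℂ :=
  Matrix.of fun j k => Fin.addCases
    (fun i : Fin n =>
      (∏ l : Fin m, (β * u i + w (Fin.natAdd r l)) / (β * u i - w (Fin.natAdd r l))) *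
        ((aFun β w (u i) * dFun w (v k) - aFun β w (v k) * dFun w (u i)) / (v k - u i)))
    (fun i : Fin m =>
      1 / w (Fin.natAdd r i) *
        ∏ l ∈ Finset.univ.erase (Fin.natAdd r i), (1 - β * v k / w l))
    j

/-- The determinant expression for the intermediate scalar product. -/
noncomputable def intermediateFormula {n m r : ℕ} (β : ℂ) (u : Fin n → ℂ) (v : Fin (n + m) → ℂ)
    (w : Fin (r + m) → ℂ) : ℂ :=
  (∏ j, 2 * v j) *
    (∏ j, ∏ k ∈ Finset.Ioi j, (v j + v k) / (v k - v j)) *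
    (∏ j : Fin m, ∏ k ∈ Finset.Ioi j,
      1 / (β * (1 - w (Fin.natAdd r k) / w (Fin.natAdd r j)))) *
    (∏ j, ∏ k ∈ Finset.Ioi j, (u j + u k) / (u j - u k)) *
    (intermediateMatrix β u v w).det

/-- The points `(β, u, v, w)` at which no denominator of `intermediateFormula` vanishes. -/
def genericAll (n m r : ℕ) :
    Set (ℂ × (Fin n → ℂ) × (Fin (n + m) → ℂ) × (Fin (r + m) → ℂ)) :=
  {p | match p with
    | (β, u, v, w) =>
      Function.Injective u ∧ Function.Injective v ∧ (∀ j k, u j ≠ v k) ∧ (∀ l, w l ≠ 0) ∧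
        (∀ j (l : Fin m), β * u j - w (Fin.natAdd r l) ≠ 0) ∧
        ∀ j k : Fin m, j < k → β ≠ 0 ∧ w (Fin.natAdd r j) ≠ w (Fin.natAdd r k)}

end SixVertex

/-! The proof inducts on the number of sites, removing site 1, which carries the last inhomogeneity
`z = w (Fin.last M)`; no Bethe equations or analytic characterisation of the scalar product are
needed. `monodromy_succ` splits off the factor of site 1. The relation `monodromy_rtt` makes the
`𝓑`'s commute, likewise the `𝓒`'s, and gives the exchange rules that move `𝓐` through `𝓑` and `𝓓`
through `𝓒`. Hence (`offShell_exchange`, `offShell_component`) the components of an off-shell state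
at site 1 are off-shell states on the remaining sites: the `|0⟩` component keeps all parameters, and
the `|1⟩` component is a sum over the one parameter removed. Pairing bra and ket gives the recursion
`scalarProduct_succ`: one term of the same size and a double sum of terms with one `u` and one `v`
deleted. On the determinant side, adding a site rescales rows and columns and adds a rank-one
matrix; expanding that perturbation into minors (`det_add_rank_one_fin_succ`) reproduces the
recursion, which proves `scalarProduct_eq_det`. For the intermediate product, site 1 of the bra is
occupied, so only the `|1⟩` component survives and a single sum over deleted `v` remains
(`intermediate_succ`). After row operations this is the Laplace expansion of the determinant along
its last row (`intermediate_eq_det`); the induction on `m` starts from the full scalar product. The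
exceptional parameters follow because the left-hand sides are continuous wherever all `w` are
nonzero. -/

namespace SixVertex

/-! ### Tensor splitting of the first site and the monodromy recursion. -/

/-- The operator acting as `X` on the first site and as `Y` on the remaining ones. -/
def tensorCons {M : ℕ} (X : Matrix (Fin 2) (Fin 2) ℂ) (Y : QOp M) : QOp (M + 1) :=
  fun c n => X (c 0) (n 0) * Y (Fin.tail c) (Fin.tail n)

theorem sum_config_succ {M : ℕ} {α : Type*} [AddCommMonoid α] (f : Config (M + 1) → α) :
    ∑ c, f c = ∑ i : Fin 2, ∑ c : Config M, f (Fin.cons i c) := by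
  rw [← (Fin.consEquiv fun _ : Fin (M + 1) => Fin 2).sum_comp, Fintype.sum_prod_type]
  rfl

theorem tensorCons_mul {M : ℕ} (X X' : Matrix (Fin 2) (Fin 2) ℂ) (Y Y' : QOp M) :
    tensorCons X Y * tensorCons X' Y' = tensorCons (X * X') (Y * Y') := by
  ext c n
  simp only [tensorCons, Matrix.mul_apply, sum_config_succ, Fin.cons_zero, Fin.tail_cons,
    Finset.sum_mul_sum]
  exact Finset.sum_congr rfl fun i _ => Finset.sum_congr rfl fun j _ => by ring

theorem tensorCons_one {M : ℕ} : tensorCons (1 : Matrix (Fin 2) (Fin 2) ℂ) (1 : QOp M) = 1 := by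
  ext c n
  induction c using Fin.consCases with | _ i c => ?_
  induction n using Fin.consCases with | _ j n => ?_
  simp only [tensorCons, Matrix.one_apply, Fin.cons_zero, Fin.tail_cons, Fin.cons_inj]
  split_ifs <;> simp_all

theorem tensorCons_add_right {M : ℕ} (X : Matrix (Fin 2) (Fin 2) ℂ) (Y Y' : QOp M) :
    tensorCons X (Y + Y') = tensorCons X Y + tensorCons X Y' := by
  ext c n
  simp only [tensorCons, Matrix.add_apply, mul_add]

theorem tensorCons_add_left {M : ℕ} (X X' : Matrix (Fin 2) (Fin 2) ℂ) (Y : QOp M) :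
    tensorCons (X + X') Y = tensorCons X Y + tensorCons X' Y := by
  ext c n
  simp only [tensorCons, Matrix.add_apply, add_mul]

theorem tensorCons_smul_right {M : ℕ} (t : ℂ) (X : Matrix (Fin 2) (Fin 2) ℂ) (Y : QOp M) :
    tensorCons X (t • Y) = t • tensorCons X Y := by
  ext c n
  simp only [tensorCons, Matrix.smul_apply, smul_eq_mul]
  ring

theorem tensorCons_smul_left {M : ℕ} (t : ℂ) (X : Matrix (Fin 2) (Fin 2) ℂ) (Y : QOp M) :
    tensorCons (t • X) Y = t • tensorCons X Y := by
  ext c n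
  simp only [tensorCons, Matrix.smul_apply, smul_eq_mul]
  ring

/-- The embedding of operators on `M` sites as operators acting trivially on a new first site. -/
def idTensor (M : ℕ) : QOp M →+* QOp (M + 1) where
  toFun := tensorCons 1
  map_one' := tensorCons_one
  map_mul' Y Y' := by rw [tensorCons_mul, one_mul]
  map_zero' := by ext; simp [tensorCons]
  map_add' Y Y' := by ext; simp [tensorCons, mul_add]

theorem siteOp_zero {M : ℕ} (X : Matrix (Fin 2) (Fin 2) ℂ) :
    siteOp (0 : Fin (M + 1)) X = tensorCons X 1 := by
  ext c n
  have : (∀ i : Fin (M + 1), i ≠ 0 → c i = n i) ↔ Fin.tail c = Fin.tail n := by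
    simp [Fin.forall_fin_succ, funext_iff, Fin.tail]
  simp only [siteOp, tensorCons, this, Matrix.one_apply, mul_ite, mul_one, mul_zero]

theorem siteOp_succ {M : ℕ} (j : Fin M) (X : Matrix (Fin 2) (Fin 2) ℂ) :
    siteOp j.succ X = idTensor M (siteOp j X) := by
  ext c n
  have : (∀ i : Fin (M + 1), i ≠ j.succ → c i = n i) ↔
      c 0 = n 0 ∧ ∀ i, i ≠ j → Fin.tail c i = Fin.tail n i := by
    simp [Fin.forall_fin_succ, Fin.tail, (Fin.succ_ne_zero _).symm]
  simp only [siteOp, idTensor, RingHom.coe_mk, MonoidHom.coe_mk, OneHom.coe_mk, tensorCons, this,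
    Matrix.one_apply]
  by_cases h0 : c 0 = n 0
  · simp only [h0, Fin.tail, true_and, if_true, one_mul]
    congr
  · simp [h0]

theorem monodromy_succ {M : ℕ} (β : ℂ) (w : Fin (M + 1) → ℂ) (v : ℂ) (a b : Fin 2) :
    monodromy β w v a b = ∑ e, tensorCons (lOperator β (v / w (Fin.last M)) e b)
      (monodromy β (fun j => w j.castSucc) v a e) := by
  have h : (List.ofFn fun j : Fin M =>
        (lOperator β (v / w j.succ.rev)).map (siteOp j.succ)).reverse.prod =
      (idTensor M).mapMatrix (monodromy β (fun j => w j.castSucc) v) := by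
    rw [monodromy, map_list_prod, List.map_reverse, List.map_ofFn]
    congr 3
    funext j
    ext e f
    simp [siteOp_succ, Fin.rev_succ]
  rw [monodromy, List.ofFn_succ, List.reverse_cons, List.prod_append, List.prod_singleton, h,
    Matrix.mul_apply]
  refine Finset.sum_congr rfl fun e _ => ?_
  simp only [RingHom.mapMatrix_apply, Matrix.map_apply, Fin.rev_zero, siteOp_zero]
  change tensorCons 1 _ * _ = _
  rw [tensorCons_mul, one_mul, mul_one]

/-! ### The RTT relation and continuity of the monodromy matrix. -/

/-- The (polynomially normalised) `R`-matrix at `t = -1`, multiplied by the permutation. -/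
def rMatrix (x y : ℂ) (i j p q : Fin 2) : ℂ :=
  if p = i ∧ q = j then (if i = j then x + y else if i = 0 then 2 * y else 2 * x)
  else if p = j ∧ q = i then (if i = 0 then x - y else y - x) else 0

set_option maxHeartbeats 1600000 in
theorem lOperator_rtt (β x y z : ℂ) (i j k l : Fin 2) :
    ∑ p, ∑ q, rMatrix x y i j p q • (lOperator β (x / z) p k * lOperator β (y / z) q l) =
      ∑ p, ∑ q, rMatrix x y p q k l • (lOperator β (y / z) i p * lOperator β (x / z) j q) := by
  ext s t
  -- There are 64 scalar identities: four auxiliary indices and two physical ones.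
  fin_cases i <;> fin_cases j <;> fin_cases k <;> fin_cases l <;> fin_cases s <;> fin_cases t <;>
    simp [rMatrix, lOperator, Fin.sum_univ_two, -mul_eq_mul_left_iff] <;> ring

/-- The `R`-matrix is carried first through the remaining sites (induction) and then through site 1
(`lOperator_rtt`); both sides are brought to the form in which it sits between the two, on the
summed auxiliary indices. -/
theorem monodromy_rtt {M : ℕ} (β : ℂ) (w : Fin M → ℂ) (x y : ℂ) (i j k l : Fin 2) :
    ∑ p, ∑ q, rMatrix x y i j p q • (monodromy β w x p k * monodromy β w y q l) =
      ∑ p, ∑ q, rMatrix x y p q k l • (monodromy β w y i p * monodromy β w x j q) := by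
  induction M generalizing i j k l with
  | zero =>
    have h : ∀ v, monodromy β w v = 1 := fun v => by simp [monodromy]
    simp only [h, Fin.sum_univ_two]
    revert i j k l
    simp [Fin.forall_fin_two, rMatrix]
  | succ M ih =>
    have hT : ∀ (s t : ℂ) (p q k l : Fin 2), monodromy β w s p k * monodromy β w t q l =
        ∑ e, ∑ g, tensorCons
          (lOperator β (s / w (Fin.last M)) e k * lOperator β (t / w (Fin.last M)) g l)
          (monodromy β (fun j => w j.castSucc) s p e *
            monodromy β (fun j => w j.castSucc) t q g) := by
      intro s t p q k l
      simp only [monodromy_succ, Finset.sum_mul_sum, tensorCons_mul]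
    have h1 : ∑ p, ∑ q, rMatrix x y i j p q • (monodromy β w x p k * monodromy β w y q l) =
        ∑ e, ∑ g, tensorCons
          (lOperator β (x / w (Fin.last M)) e k * lOperator β (y / w (Fin.last M)) g l)
          (∑ p, ∑ q, rMatrix x y i j p q • (monodromy β (fun j => w j.castSucc) x p e *
            monodromy β (fun j => w j.castSucc) y q g)) := by
      simp only [hT, Fin.sum_univ_two, tensorCons_add_right, tensorCons_smul_right, smul_add]
      abel
    have h2 : ∑ p, ∑ q, rMatrix x y p q k l • (monodromy β w y i p * monodromy β w x j q) =
        ∑ e, ∑ g, tensorCons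
          (∑ p, ∑ q, rMatrix x y p q k l • (lOperator β (y / w (Fin.last M)) e p *
            lOperator β (x / w (Fin.last M)) g q))
          (monodromy β (fun j => w j.castSucc) y i e *
            monodromy β (fun j => w j.castSucc) x j g) := by
      simp only [hT, Fin.sum_univ_two, tensorCons_add_left, tensorCons_smul_left, smul_add]
      abel
    rw [h1, h2]
    simp only [ih, ← lOperator_rtt]
    simp only [Fin.sum_univ_two, tensorCons_add_right, tensorCons_smul_right,
      tensorCons_add_left, tensorCons_smul_left]
    abel

theorem continuousAt_monodromy {X : Type*} [TopologicalSpace X] {x₀ : X} {M : ℕ} {β v : X → ℂ}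
    {w : X → Fin M → ℂ} (hβ : ContinuousAt β x₀) (hw : ContinuousAt w x₀)
    (hv : ContinuousAt v x₀) (hw0 : ∀ l, w x₀ l ≠ 0) (a b : Fin 2) :
    ContinuousAt (fun x => monodromy (β x) (w x) (v x) a b) x₀ := by
  induction M generalizing a b with
  | zero =>
    simp only [monodromy, List.ofFn_zero, List.reverse_nil, List.prod_nil]
    exact continuousAt_const
  | succ M ih =>
    have hwl : ∀ l, ContinuousAt (fun x => w x l) x₀ := fun l => continuousAt_pi.1 hw l
    have hdiv := hv.div (hwl (Fin.last M)) (hw0 _)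
    simp only [monodromy_succ]
    refine continuousAt_pi.2 fun c => continuousAt_pi.2 fun n => ?_
    simp only [Matrix.sum_apply, tensorCons]
    refine tendsto_finsetSum _ fun e _ => ContinuousAt.mul ?_ ?_
    · generalize c 0 = s
      generalize n 0 = t
      fin_cases e <;> fin_cases b <;> fin_cases s <;> fin_cases t <;>
        simp [lOperator] <;> first | exact hdiv | exact continuousAt_const | skip
      · exact continuousAt_const.sub (hβ.mul hdiv)
      · exact continuousAt_const.add (hβ.mul hdiv)
      · exact continuousAt_const.mul hdiv
    · exact continuousAt_pi.1 (continuousAt_pi.1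
        (ih (w := fun x j => w x j.castSucc) (continuousAt_pi.2 fun l => hwl l.castSucc)
          (fun l => hw0 _) a e) (Fin.tail c)) (Fin.tail n)

/-! ### Off-shell vectors of an abstract commuting family. -/

theorem pairwise_commute_comp {R ι : Type*} [Monoid R] {B : ℂ → R}
    (hB : ∀ x y, Commute (B x) (B y)) (v : ι → ℂ) (s : Finset ι) :
    (s : Set ι).Pairwise (Function.onFun Commute fun i => B (v i)) :=
  fun _ _ _ _ _ => hB _ _

/-- The off-shell vector `∏_{i ∈ s} B(v_i) e` for a commuting family of operators `B(x)`. -/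
noncomputable def offShell {E ι : Type*} [AddCommGroup E] [Module ℂ E] {B : ℂ → Module.End ℂ E}
    (hB : ∀ x y, Commute (B x) (B y)) (e : E) (v : ι → ℂ) (s : Finset ι) : E :=
  s.noncommProd (fun i => B (v i)) (pairwise_commute_comp hB v s) e

section OffShell

variable {E ι κ : Type*} [AddCommGroup E] [Module ℂ E] {B : ℂ → Module.End ℂ E}
  (hB : ∀ x y, Commute (B x) (B y)) (e : E) (v : ι → ℂ)

theorem offShell_empty : offShell hB e v ∅ = e := by
  rw [offShell, Finset.noncommProd_empty, Module.End.one_apply]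

theorem offShell_insert [DecidableEq ι] {s : Finset ι} {i : ι} (hi : i ∉ s) :
    offShell hB e v (insert i s) = B (v i) (offShell hB e v s) := by
  rw [offShell, Finset.noncommProd_insert_of_notMem _ _ _ _ hi, Module.End.mul_apply, offShell]

theorem offShell_map (φ : κ ↪ ι) (s : Finset κ) :
    offShell hB e v (s.map φ) = offShell hB e (fun k => v (φ k)) s := by
  simp [offShell, Finset.noncommProd, Multiset.map_map]

theorem offShell_univ_erase {N : ℕ} (v : Fin (N + 1) → ℂ) (k : Fin (N + 1)) :
    offShell hB e v (Finset.univ.erase k) =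
      offShell hB e (fun j => v (k.succAbove j)) Finset.univ := by
  have : Finset.univ.erase k = Finset.univ.map k.succAboveEmb := by
    rw [Fin.univ_succAbove _ k, Finset.erase_cons]
  rw [this, offShell_map]
  rfl

theorem offShell_univ_eq {N : ℕ} (v : Fin N → ℂ) :
    offShell hB e v Finset.univ = (List.ofFn fun k => B (v k)).prod e := by
  simp [offShell, Finset.noncommProd, Fin.univ_val_map]

variable {hB e v}

/-- This is the usual wanted/unwanted-term computation of the algebraic Bethe ansatz. It is kept
abstract so that it serves both `𝓐` on kets and `𝓓` on bras. The identity `hfg` merges the two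
contributions to each unwanted term into a single product. -/
theorem offShell_exchange [DecidableEq ι] {A : ℂ → Module.End ℂ E} {f g : ℂ → ℂ → ℂ} {a : ℂ → ℂ}
    (hAB : ∀ x y, x ≠ y → ∀ e, A x (B y e) = f x y • B y (A x e) + g x y • B x (A y e))
    (hA : ∀ x, A x e = a x • e)
    (hfg : ∀ x y z, x ≠ y → x ≠ z → y ≠ z → f x y * g x z + g x y * g y z = g x z * f z y)
    {s : Finset ι} (hs : Set.InjOn v s) {x : ℂ} (hx : ∀ i ∈ s, x ≠ v i) :
    A x (offShell hB e v s) = (a x * ∏ i ∈ s, f x (v i)) • offShell hB e v s +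
      ∑ k ∈ s, (a (v k) * g x (v k) * ∏ i ∈ s.erase k, f (v k) (v i)) •
        B x (offShell hB e v (s.erase k)) := by
  induction s using Finset.induction_on generalizing x with
  | empty => simp [offShell_empty, hA]
  | insert y s hy ih =>
    have hs' : Set.InjOn v s := hs.mono (by simp)
    have hys : ∀ i ∈ s, v y ≠ v i := fun i hi h => hy (by
      rwa [hs (Finset.mem_insert_self _ _) (Finset.mem_insert_of_mem hi) h])
    have hxy : x ≠ v y := hx y (Finset.mem_insert_self _ _)
    have hxs : ∀ i ∈ s, x ≠ v i := fun i hi => hx i (Finset.mem_insert_of_mem hi)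
    rw [offShell_insert _ _ _ hy, hAB _ _ hxy, ih hs' hxs, ih hs' hys, Finset.sum_insert hy,
      Finset.prod_insert hy, Finset.erase_insert hy]
    have hsum : ∑ k ∈ s, (a (v k) * g x (v k) * ∏ i ∈ (insert y s).erase k, f (v k) (v i)) •
        B x (offShell hB e v ((insert y s).erase k)) =
        ∑ k ∈ s, (f x (v y) • B (v y) ((a (v k) * g x (v k) * ∏ i ∈ s.erase k, f (v k) (v i)) •
          B x (offShell hB e v (s.erase k))) + g x (v y) • B x ((a (v k) * g (v y) (v k) *
          ∏ i ∈ s.erase k, f (v k) (v i)) • B (v y) (offShell hB e v (s.erase k)))) := by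
      refine Finset.sum_congr rfl fun k hk => ?_
      have hky : k ≠ y := fun h => hy (h ▸ hk)
      have hcomm : B (v y) (B x (offShell hB e v (s.erase k))) =
          B x (B (v y) (offShell hB e v (s.erase k))) :=
        LinearMap.congr_fun (hB (v y) x) _
      rw [Finset.erase_insert_of_ne hky.symm, Finset.prod_insert (by simp [hy]),
        offShell_insert _ _ _ (by simp [hy]), map_smul, map_smul, hcomm, smul_smul, smul_smul,
        ← add_smul]
      congr 1
      -- Deleting `k` arises in two ways: through `A x` after passing `B (v y)`, or through `A (v
      -- y)` after the exchange.
      linear_combination (-a (v k) * ∏ i ∈ s.erase k, f (v k) (v i)) *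
        hfg x (v y) (v k) hxy (hxs k hk) (hys k hk)
    rw [hsum, Finset.sum_add_distrib]
    simp only [map_add, map_sum, smul_add, Finset.smul_sum, map_smul, smul_smul]
    module

/-- Here `q` and `p` are the diagonal weights of the split-off site in states 0 and 1, and `c` is
the weight of the transition between them. Applying `A` to the 0-component by `offShell_exchange`
creates unwanted terms, which `hpq` combines with those already present in the 1-component. -/
theorem offShell_component [DecidableEq ι] {A : ℂ → Module.End ℂ E} {f g : ℂ → ℂ → ℂ}
    {a p q c : ℂ → ℂ} {c₀ c₁ : Finset ι → E}
    (hAB : ∀ x y, x ≠ y → ∀ e, A x (B y e) = f x y • B y (A x e) + g x y • B x (A y e))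
    (hA : ∀ x, A x e = a x • e)
    (hfg : ∀ x y z, x ≠ y → x ≠ z → y ≠ z → f x y * g x z + g x y * g y z = g x z * f z y)
    (hpq : ∀ x z, x ≠ z → p x * c z + c x * q z * g x z = c z * q x * f z x)
    (h₀ : c₀ ∅ = e) (h₁ : c₁ ∅ = 0)
    (h₀' : ∀ i s, i ∉ s → c₀ (insert i s) = q (v i) • B (v i) (c₀ s))
    (h₁' : ∀ i s, i ∉ s →
      c₁ (insert i s) = p (v i) • B (v i) (c₁ s) + c (v i) • A (v i) (c₀ s))
    {s : Finset ι} (hs : Set.InjOn v s) :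
    c₀ s = (∏ i ∈ s, q (v i)) • offShell hB e v s ∧
    c₁ s = ∑ k ∈ s, (c (v k) * a (v k) * ∏ i ∈ s.erase k, (q (v i) * f (v k) (v i))) •
      offShell hB e v (s.erase k) := by
  induction s using Finset.induction_on with
  | empty => simp [offShell_empty, h₀, h₁]
  | insert y s hy ih =>
    have hs' : Set.InjOn v s := hs.mono (by simp)
    have hys : ∀ i ∈ s, v y ≠ v i := fun i hi h => hy (by
      rwa [hs (Finset.mem_insert_self _ _) (Finset.mem_insert_of_mem hi) h])
    obtain ⟨ih₀, ih₁⟩ := ih hs'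
    constructor
    · rw [h₀' _ _ hy, ih₀, map_smul, smul_smul, Finset.prod_insert hy, offShell_insert _ _ _ hy]
    · have hsum : ∑ k ∈ s, (c (v k) * a (v k) *
          ∏ i ∈ (insert y s).erase k, (q (v i) * f (v k) (v i))) •
          offShell hB e v ((insert y s).erase k) =
          ∑ k ∈ s, (p (v y) • B (v y) ((c (v k) * a (v k) *
              ∏ i ∈ s.erase k, (q (v i) * f (v k) (v i))) • offShell hB e v (s.erase k)) +
            c (v y) • (∏ i ∈ s, q (v i)) • ((a (v k) * g (v y) (v k) *
              ∏ i ∈ s.erase k, f (v k) (v i)) • B (v y) (offShell hB e v (s.erase k)))) := by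
        refine Finset.sum_congr rfl fun k hk => ?_
        have hky : k ≠ y := fun h => hy (h ▸ hk)
        rw [Finset.erase_insert_of_ne hky.symm, Finset.prod_insert (by simp [hy]),
          offShell_insert _ _ _ (by simp [hy]), map_smul, smul_smul, smul_smul, smul_smul,
          ← add_smul, ← Finset.mul_prod_erase s (fun i => q (v i)) hk, Finset.prod_mul_distrib]
        congr 1
        linear_combination (-a (v k) * (∏ i ∈ s.erase k, q (v i)) *
          ∏ i ∈ s.erase k, f (v k) (v i)) * hpq (v y) (v k) (hys k hk)
      rw [h₁' _ _ hy, ih₀, ih₁, map_smul, offShell_exchange hAB hA hfg hs' hys,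
        Finset.sum_insert hy, Finset.erase_insert hy, hsum, Finset.sum_add_distrib,
        Finset.prod_mul_distrib]
      simp only [map_sum, smul_add, Finset.smul_sum, map_smul, smul_smul]
      module

end OffShell

/-! ### Rank-one perturbations of determinants and products over pairs. -/

theorem det_add_rank_one_eq_sum_updateRow {n R : Type*} [Fintype n] [DecidableEq n] [CommRing R]
    (A : Matrix n n R) (u v : n → R) :
    (Matrix.of fun i j => A i j + u i * v j).det =
      A.det + ∑ i, u i * (A.updateRow i v).det := by
  -- The rank-one term is switched on one row at a time.
  have key : ∀ s : Finset n, (Matrix.of fun i j => A i j + (if i ∈ s then u i else 0) * v j).det =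
      A.det + ∑ i ∈ s, u i * (A.updateRow i v).det := by
    intro s
    induction s using Finset.induction_on with
    | empty =>
      simp only [Finset.notMem_empty, if_false, zero_mul, add_zero, Finset.sum_empty]
      rfl
    | insert a s ha ih =>
      set As : Matrix n n R := Matrix.of fun i j => A i j + (if i ∈ s then u i else 0) * v j
      have h1 : (Matrix.of fun i j => A i j + (if i ∈ insert a s then u i else 0) * v j) =
          As.updateRow a (As a + u a • v) := by
        ext i j
        by_cases hi : i = a
        · subst hi
          simp [As, ha]
        · simp [As, hi]
      have h2 : (As.updateRow a v).det = (A.updateRow a v).det := by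
        -- Once row `a` equals `v`, the perturbations of the other rows are multiples of that row
        -- and do not affect the determinant.
        refine Matrix.det_eq_of_forall_row_eq_smul_add_const
          (fun i => if i ∈ s then u i else 0) a (by simp [ha]) fun i j => ?_
        by_cases hi : i = a
        · subst hi
          simp [ha]
        · simp [As, hi]
      rw [h1, Matrix.det_updateRow_add, Matrix.det_updateRow_smul, Matrix.updateRow_eq_self, ih,
        h2, Finset.sum_insert ha]
      ring
  simpa using key Finset.univ

theorem det_add_rank_one_fin_succ {R : Type*} [CommRing R] {n : ℕ}
    (A : Matrix (Fin (n + 1)) (Fin (n + 1)) R) (u v : Fin (n + 1) → R) :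
    (Matrix.of fun i j => A i j + u i * v j).det =
      A.det + ∑ i : Fin (n + 1), ∑ j : Fin (n + 1), (-1) ^ (i + j : ℕ) * (u i * v j) *
        (A.submatrix i.succAbove j.succAbove).det := by
  rw [det_add_rank_one_eq_sum_updateRow]
  congr 1
  refine Finset.sum_congr rfl fun i _ => ?_
  rw [Matrix.det_succ_row _ i, Finset.mul_sum]
  refine Finset.sum_congr rfl fun j _ => ?_
  rw [Matrix.updateRow_self, Matrix.submatrix_updateRow_succAbove]
  ring

theorem det_scale_rows_cols {n R : Type*} [Fintype n] [DecidableEq n] [CommRing R]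
    (A : Matrix n n R) (p q : n → R) :
    (Matrix.of fun i j => p i * q j * A i j).det = (∏ i, p i) * (∏ j, q j) * A.det := by
  have : (Matrix.of fun i j => p i * q j * A i j) =
      Matrix.of fun i j => p i * (Matrix.of fun i j => q j * A i j) i j := by
    ext i j
    simp [mul_assoc]
  rw [this, Matrix.det_mul_column, Matrix.det_mul_row, mul_assoc]

/-- `∏_{j < k} F j k`. -/
def pairProd {R : Type*} [CommMonoid R] {N : ℕ} (F : Fin N → Fin N → R) : R :=
  ∏ j, ∏ k ∈ Finset.Ioi j, F j k

theorem pairProd_eq {R : Type*} [CommMonoid R] {N : ℕ} (F : Fin N → Fin N → R) :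
    pairProd F = ∏ j, ∏ k, if j < k then F j k else 1 := by
  refine Finset.prod_congr rfl fun j _ => ?_
  rw [← Finset.prod_filter]
  congr 1
  ext k
  simp

theorem pairProd_succAbove {R : Type*} [CommMonoid R] {N : ℕ} (F : Fin (N + 1) → Fin (N + 1) → R)
    (p : Fin (N + 1)) :
    pairProd F = (∏ i : Fin N, if p < p.succAbove i then F p (p.succAbove i)
        else F (p.succAbove i) p) *
      pairProd fun j k => F (p.succAbove j) (p.succAbove k) := by
  simp only [pairProd_eq]
  rw [Fin.prod_univ_succAbove _ p, Fin.prod_univ_succAbove _ p]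
  simp only [lt_irrefl, if_false, one_mul]
  simp only [Fin.prod_univ_succAbove _ p, Fin.succAbove_lt_succAbove_iff]
  rw [Finset.prod_mul_distrib, ← mul_assoc, ← Finset.prod_mul_distrib]
  congr 1
  refine Finset.prod_congr rfl fun i _ => ?_
  rcases lt_or_gt_of_ne (Fin.succAbove_ne p i) with h | h
  · simp [h, h.not_gt]
  · simp [h, h.not_gt]

theorem card_succAbove_lt {N : ℕ} (p : Fin (N + 1)) :
    (Finset.univ.filter fun i : Fin N => p.succAbove i < p).card = p := by
  have : (Finset.univ.filter fun i : Fin N => p.succAbove i < p).map p.succAboveEmb =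
      Finset.Iio p := by
    ext k
    simp only [Finset.mem_map, Finset.mem_filter, Finset.mem_univ, true_and, Fin.succAboveEmb_apply,
      Finset.mem_Iio]
    constructor
    · rintro ⟨i, hi, rfl⟩
      exact hi
    · intro hk
      obtain ⟨i, rfl⟩ := Fin.exists_succAbove_eq hk.ne
      exact ⟨i, hk, rfl⟩
  rw [← Finset.card_map p.succAboveEmb, this, Fin.card_Iio]

/-- Exactly `p` indices lie below `p`, and each such pair is reversed at the cost of a sign. These
signs later cancel the cofactor signs. -/
theorem pairProd_succAbove_of_antisymm {N : ℕ} {F : Fin (N + 1) → Fin (N + 1) → ℂ}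
    (hF : ∀ i j, F i j = -F j i) (p : Fin (N + 1)) :
    pairProd F = (-1) ^ (p : ℕ) * (∏ i : Fin N, F p (p.succAbove i)) *
      pairProd fun j k => F (p.succAbove j) (p.succAbove k) := by
  rw [pairProd_succAbove F p]
  congr 1
  have : ∀ i : Fin N, (if p < p.succAbove i then F p (p.succAbove i) else F (p.succAbove i) p) =
      (if p.succAbove i < p then -1 else 1) * F p (p.succAbove i) := by
    intro i
    rcases lt_or_gt_of_ne (Fin.succAbove_ne p i) with h | h
    · simp [h, h.not_gt, hF p]
    · simp [h, h.not_gt]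
  simp only [this]
  rw [Finset.prod_mul_distrib, Finset.prod_ite, Finset.prod_const, card_succAbove_lt]
  simp

/-! ### Exchange relations and the action on the vacuum. -/

section Relations

variable {M : ℕ} (β : ℂ) (w : Fin M → ℂ)

theorem commute_monodromy_of_ne {x y : ℂ} (h : x + y ≠ 0) (i j : Fin 2) (hij : i ≠ j) :
    Commute (monodromy β w x i j) (monodromy β w y i j) := by
  have key := monodromy_rtt β w x y i i j j
  have : (x + y) • (monodromy β w x i j * monodromy β w y i j) =
      (x + y) • (monodromy β w y i j * monodromy β w x i j) := by
    fin_cases i <;> fin_cases j <;> simp [rMatrix, Fin.sum_univ_two] at hij key ⊢ <;>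
      exact key
  exact smul_right_injective _ h this

variable {w}

/-- RTT with equal indices carries the weight `x + y`, which vanishes at `y = -x`; that point is
recovered by continuity in `y`. -/
theorem commute_monodromy (hw : ∀ l, w l ≠ 0) (i j : Fin 2) (hij : i ≠ j) (x y : ℂ) :
    Commute (monodromy β w x i j) (monodromy β w y i j) := by
  have hc : Continuous fun y => monodromy β w y i j := continuous_iff_continuousAt.2 fun y =>
    continuousAt_monodromy continuousAt_const continuousAt_const continuousAt_id hw i j
  have h1 : Continuous fun y => monodromy β w x i j * monodromy β w y i j :=
    continuous_const.matrix_mul hc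
  have h2 : Continuous fun y => monodromy β w y i j * monodromy β w x i j :=
    hc.matrix_mul continuous_const
  refine congrFun (Continuous.ext_on (dense_compl_singleton (-x)) h1 h2 fun y hy => ?_) y
  exact commute_monodromy_of_ne β w (fun h => hy (by
    rw [Set.mem_singleton_iff]; linear_combination h)) i j hij

variable (w)

theorem opA_mul_opB {x y : ℂ} (h : x ≠ y) :
    monodromy β w x 0 0 * opB β w y = ((x + y) / (y - x)) • (opB β w y * monodromy β w x 0 0) +
      (-2 * y / (y - x)) • (opB β w x * monodromy β w y 0 0) := by
  have key := monodromy_rtt β w y x 0 0 1 0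
  simp [rMatrix, Fin.sum_univ_two] at key
  have h' : y - x ≠ 0 := sub_ne_zero.2 h.symm
  have : (y - x) • (monodromy β w x 0 0 * opB β w y) =
      (y + x) • (opB β w y * monodromy β w x 0 0) -
        (2 * y) • (opB β w x * monodromy β w y 0 0) := by
    simp only [opB, key]
    module
  rw [← inv_smul_smul₀ h' (monodromy β w x 0 0 * opB β w y), this]
  module

theorem opC_mul_opD {x y : ℂ} (h : x ≠ y) :
    opC β w y * monodromy β w x 1 1 = ((x + y) / (x - y)) • (monodromy β w x 1 1 * opC β w y) +
      (-2 * x / (x - y)) • (monodromy β w y 1 1 * opC β w x) := by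
  have key := monodromy_rtt β w x y 1 1 1 0
  simp [rMatrix, Fin.sum_univ_two] at key
  have h' : x - y ≠ 0 := sub_ne_zero.2 h
  have : (x - y) • (opC β w y * monodromy β w x 1 1) =
      (x + y) • (monodromy β w x 1 1 * opC β w y) -
        (2 * x) • (monodromy β w y 1 1 * opC β w x) := by
    simp only [opC, key]
    module
  rw [← inv_smul_smul₀ h' (opC β w y * monodromy β w x 1 1), this]
  module

/-- The action of `𝓑(x)` on column vectors. -/
noncomputable def endB (x : ℂ) : Module.End ℂ (Config M → ℂ) := (opB β w x).mulVecLin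

/-- The action of `𝓐(x) = ₐ⟨0| T_a(x) |0⟩ₐ` on column vectors. -/
noncomputable def endA (x : ℂ) : Module.End ℂ (Config M → ℂ) := (monodromy β w x 0 0).mulVecLin

/-- The action of `𝓒(x)` on row vectors. -/
noncomputable def endC (x : ℂ) : Module.End ℂ (Config M → ℂ) := (opC β w x).vecMulLinear

/-- The action of `𝓓(x) = ₐ⟨1| T_a(x) |1⟩ₐ` on row vectors. -/
noncomputable def endD (x : ℂ) : Module.End ℂ (Config M → ℂ) :=
  (monodromy β w x 1 1).vecMulLinear

variable {w}

theorem commute_endB (hw : ∀ l, w l ≠ 0) (x y : ℂ) : Commute (endB β w x) (endB β w y) := by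
  refine LinearMap.ext fun e => ?_
  simp only [endB, Module.End.mul_apply, Matrix.mulVecLin_apply, Matrix.mulVec_mulVec]
  exact congrArg (· *ᵥ e) (commute_monodromy β hw 0 1 (by decide) x y)

theorem commute_endC (hw : ∀ l, w l ≠ 0) (x y : ℂ) : Commute (endC β w x) (endC β w y) := by
  refine LinearMap.ext fun e => ?_
  simp only [endC, Module.End.mul_apply, Matrix.vecMulLinear_apply, Matrix.vecMul_vecMul]
  -- The right action on row vectors reverses products, hence the order `y x`.
  exact congrArg (e ᵥ* ·) (commute_monodromy β hw 1 0 (by decide) y x)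

variable (w)

theorem endA_endB (x y : ℂ) (h : x ≠ y) (e : Config M → ℂ) :
    endA β w x (endB β w y e) = ((x + y) / (y - x)) • endB β w y (endA β w x e) +
      (-2 * y / (y - x)) • endB β w x (endA β w y e) := by
  simp only [endA, endB, Matrix.mulVecLin_apply, Matrix.mulVec_mulVec, opA_mul_opB β w h,
    Matrix.add_mulVec, Matrix.smul_mulVec]

theorem endD_endC (x y : ℂ) (h : x ≠ y) (e : Config M → ℂ) :
    endD β w x (endC β w y e) = ((x + y) / (x - y)) • endC β w y (endD β w x e) +
      (-2 * x / (x - y)) • endC β w x (endD β w y e) := by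
  simp only [endC, endD, Matrix.vecMulLinear_apply, Matrix.vecMul_vecMul, opC_mul_opD β w h,
    Matrix.vecMul_add, Matrix.vecMul_smul]

theorem monodromy_zero_zero_col (x : ℂ) (c : Config M) :
    monodromy β w x 0 0 c (fun _ => 0) = if c = (fun _ => 0) then aFun β w x else 0 := by
  induction M with
  | zero => simp [monodromy, aFun, Subsingleton.elim c (fun _ => 0)]
  | succ M ih =>
    induction c using Fin.consCases with | _ i c => ?_
    have h0 : (fun _ : Fin (M + 1) => (0 : Fin 2)) = Fin.cons 0 fun _ => 0 := by
      funext j; refine Fin.cases rfl (fun _ => rfl) j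
    rw [monodromy_succ, Matrix.sum_apply]
    simp only [tensorCons, h0, Fin.tail_cons, Fin.cons_zero, Fin.sum_univ_two, ih, aFun,
      Fin.prod_univ_castSucc, Fin.cons_inj]
    fin_cases i <;> simp [lOperator, mul_div_assoc, mul_comm]

theorem monodromy_one_one_row (x : ℂ) (c : Config M) :
    monodromy β w x 1 1 (fun _ => 0) c = if c = (fun _ => 0) then dFun w x else 0 := by
  induction M with
  | zero => simp [monodromy, dFun, Subsingleton.elim c (fun _ => 0)]
  | succ M ih =>
    induction c using Fin.consCases with | _ i c => ?_
    have h0 : (fun _ : Fin (M + 1) => (0 : Fin 2)) = Fin.cons 0 fun _ => 0 := by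
      funext j; refine Fin.cases rfl (fun _ => rfl) j
    rw [monodromy_succ, Matrix.sum_apply]
    simp only [tensorCons, h0, Fin.tail_cons, Fin.cons_zero, Fin.sum_univ_two, ih, dFun,
      Fin.prod_univ_castSucc, Fin.cons_inj]
    fin_cases i <;> simp [lOperator, mul_comm]

theorem endA_vacuum (x : ℂ) :
    endA β w x (basisVec fun _ => 0) = aFun β w x • basisVec fun _ => 0 := by
  funext c
  simp [endA, basisVec, monodromy_zero_zero_col, Pi.single_apply]

theorem endD_vacuum (x : ℂ) :
    endD β w x (basisVec fun _ => 0) = dFun w x • basisVec fun _ => 0 := by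
  funext c
  simp [endD, basisVec, monodromy_one_one_row, Pi.single_apply]

end Relations

/-! ### Components of states at the first site. -/

section Components

variable {M : ℕ}

/-- The component of a vector of `M + 1` sites along `|i⟩` at the first site. -/
def component (i : Fin 2) (ξ : Config (M + 1) → ℂ) : Config M → ℂ := fun c => ξ (Fin.cons i c)

theorem dotProduct_eq_components (ξ η : Config (M + 1) → ℂ) :
    ξ ⬝ᵥ η = component 0 ξ ⬝ᵥ component 0 η + component 1 ξ ⬝ᵥ component 1 η := by
  simp [dotProduct, sum_config_succ, component]

theorem component_mulVec (i : Fin 2) (X : Matrix (Fin 2) (Fin 2) ℂ) (Y : QOp M)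
    (ξ : Config (M + 1) → ℂ) :
    component i (tensorCons X Y *ᵥ ξ) = ∑ j, X i j • (Y *ᵥ component j ξ) := by
  funext c
  simp [component, Matrix.mulVec, dotProduct, sum_config_succ, tensorCons, Finset.mul_sum,
    mul_assoc]

theorem component_vecMul (i : Fin 2) (X : Matrix (Fin 2) (Fin 2) ℂ) (Y : QOp M)
    (ξ : Config (M + 1) → ℂ) :
    component i (ξ ᵥ* tensorCons X Y) = ∑ j, X j i • (component j ξ ᵥ* Y) := by
  funext c
  simp [component, Matrix.vecMul, dotProduct, sum_config_succ, tensorCons, Finset.mul_sum,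
    mul_left_comm]

theorem component_basisVec (i j : Fin 2) (c : Config M) :
    component i (basisVec (Fin.cons j c)) = if i = j then basisVec c else 0 := by
  funext c'
  by_cases h : i = j <;> simp [component, basisVec, Pi.single_apply, Fin.cons_inj, h]

theorem const_zero_eq_cons : (fun _ : Fin (M + 1) => (0 : Fin 2)) = Fin.cons 0 fun _ => 0 := by
  funext j
  refine Fin.cases rfl (fun _ => rfl) j

theorem component_zero_vacuum :
    component 0 (basisVec fun _ : Fin (M + 1) => 0) = basisVec fun _ => 0 := by
  rw [const_zero_eq_cons, component_basisVec, if_pos rfl]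

theorem component_one_vacuum : component 1 (basisVec fun _ : Fin (M + 1) => 0) = 0 := by
  rw [const_zero_eq_cons, component_basisVec, if_neg (by decide)]

theorem component_add (i : Fin 2) (ξ η : Config (M + 1) → ℂ) :
    component i (ξ + η) = component i ξ + component i η := rfl

variable (β : ℂ) (w : Fin (M + 1) → ℂ) (x : ℂ) (ξ : Config (M + 1) → ℂ)

theorem component_zero_endB : component 0 (endB β w x ξ) =
    (x / w (Fin.last M)) • endB β (fun j => w j.castSucc) x (component 0 ξ) := by
  simp [endB, opB, monodromy_succ, component_add, component_mulVec, lOperator]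

theorem component_one_endB : component 1 (endB β w x ξ) =
    (x / w (Fin.last M)) • endB β (fun j => w j.castSucc) x (component 1 ξ) +
      (2 * (x / w (Fin.last M))) • endA β (fun j => w j.castSucc) x (component 0 ξ) := by
  simp [endB, endA, opB, monodromy_succ, component_add, component_mulVec,
    lOperator, add_comm]

theorem component_zero_endC : component 0 (endC β w x ξ) =
    (1 - β * (x / w (Fin.last M))) • endC β (fun j => w j.castSucc) x (component 0 ξ) := by
  simp [endC, opC, monodromy_succ, component_add, component_vecMul, lOperator]

theorem component_one_endC : component 1 (endC β w x ξ) =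
    (1 + β * (x / w (Fin.last M))) • endC β (fun j => w j.castSucc) x (component 1 ξ) +
      (1 : ℂ) • endD β (fun j => w j.castSucc) x (component 0 ξ) := by
  simp [endC, endD, opC, monodromy_succ, component_add, component_vecMul,
    lOperator]

end Components

section OffShellComponents

variable {M : ℕ} {ι : Type*} [DecidableEq ι] (β : ℂ) {w : Fin (M + 1) → ℂ}
  (hw : ∀ l, w l ≠ 0) {v : ι → ℂ} {s : Finset ι}

theorem component_offShell_endB (hs : Set.InjOn v s) :
    component 0 (offShell (commute_endB β hw) (basisVec fun _ => 0) v s) =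
      (∏ i ∈ s, v i / w (Fin.last M)) • offShell (commute_endB β fun j => hw j.castSucc)
        (basisVec fun _ => 0) v s ∧
    component 1 (offShell (commute_endB β hw) (basisVec fun _ => 0) v s) =
      ∑ k ∈ s, (2 * (v k / w (Fin.last M)) * aFun β (fun j => w j.castSucc) (v k) *
        ∏ i ∈ s.erase k, (v i / w (Fin.last M) * ((v k + v i) / (v i - v k)))) •
        offShell (commute_endB β fun j => hw j.castSucc) (basisVec fun _ => 0) v (s.erase k) := by
  refine offShell_component (p := fun x => x / w (Fin.last M)) (q := fun x => x / w (Fin.last M))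
    (c := fun x => 2 * (x / w (Fin.last M))) (f := fun x y => (x + y) / (y - x))
    (g := fun x y => -2 * y / (y - x)) (hB := commute_endB β fun j => hw j.castSucc)
    (c₀ := fun s => component 0 (offShell (commute_endB β hw) (basisVec fun _ => 0) v s))
    (c₁ := fun s => component 1 (offShell (commute_endB β hw) (basisVec fun _ => 0) v s))
    (endA_endB β _) (endA_vacuum β _) ?_ ?_ ?_ ?_ ?_ ?_ hs
  · intro x y z hxy hxz hyz
    have h1 := sub_ne_zero.2 hxy.symm
    have h2 := sub_ne_zero.2 hxz.symm
    have h3 := sub_ne_zero.2 hyz.symm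
    have h4 := sub_ne_zero.2 hyz
    field_simp
    ring
  · intro x z hxz
    have h1 := sub_ne_zero.2 hxz.symm
    have h2 := sub_ne_zero.2 hxz
    have h3 := hw (Fin.last M)
    field_simp
    ring
  · simp only [offShell_empty, component_zero_vacuum]
  · simp only [offShell_empty, component_one_vacuum]
  · intro i s hi
    simp only [offShell_insert _ _ _ hi, component_zero_endB]
  · intro i s hi
    simp only [offShell_insert _ _ _ hi, component_one_endB]

theorem component_offShell_endC (hs : Set.InjOn v s) :
    component 0 (offShell (commute_endC β hw) (basisVec fun _ => 0) v s) =
      (∏ i ∈ s, (1 - β * (v i / w (Fin.last M)))) • offShell (commute_endC β fun j => hw j.castSucc)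
        (basisVec fun _ => 0) v s ∧
    component 1 (offShell (commute_endC β hw) (basisVec fun _ => 0) v s) =
      ∑ k ∈ s, (1 * dFun (fun j => w j.castSucc) (v k) *
        ∏ i ∈ s.erase k, ((1 - β * (v i / w (Fin.last M))) * ((v k + v i) / (v k - v i)))) •
        offShell (commute_endC β fun j => hw j.castSucc) (basisVec fun _ => 0) v (s.erase k) := by
  refine offShell_component (p := fun x => 1 + β * (x / w (Fin.last M)))
    (q := fun x => 1 - β * (x / w (Fin.last M)))
    (c := fun _ => 1) (f := fun x y => (x + y) / (x - y))
    (g := fun x y => -2 * x / (x - y)) (hB := commute_endC β fun j => hw j.castSucc)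
    (c₀ := fun s => component 0 (offShell (commute_endC β hw) (basisVec fun _ => 0) v s))
    (c₁ := fun s => component 1 (offShell (commute_endC β hw) (basisVec fun _ => 0) v s))
    (endD_endC β _) (endD_vacuum β _) ?_ ?_ ?_ ?_ ?_ ?_ hs
  · intro x y z hxy hxz hyz
    have h1 := sub_ne_zero.2 hxy
    have h2 := sub_ne_zero.2 hxz
    have h3 := sub_ne_zero.2 hyz
    have h4 := sub_ne_zero.2 hyz.symm
    field_simp
    ring
  · intro x z hxz
    have h1 := sub_ne_zero.2 hxz.symm
    have h2 := sub_ne_zero.2 hxz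
    have h3 := hw (Fin.last M)
    field_simp
    ring
  · simp only [offShell_empty, component_zero_vacuum]
  · simp only [offShell_empty, component_one_vacuum]
  · intro i s hi
    simp only [offShell_insert _ _ _ hi, component_zero_endC]
  · intro i s hi
    simp only [offShell_insert _ _ _ hi, component_one_endC]

/-- No entry of `𝓒` takes the bra `⟨1|` of the split-off site to `⟨0|`, so that site stays occupied
and each `𝓒` contributes only the weight `1 + β v / w`. -/
theorem component_offShell_endC_of_one (c : Config M) (s : Finset ι) :
    component 0 (offShell (commute_endC β hw) (basisVec (Fin.cons 1 c)) v s) = 0 ∧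
    component 1 (offShell (commute_endC β hw) (basisVec (Fin.cons 1 c)) v s) =
      (∏ i ∈ s, (1 + β * (v i / w (Fin.last M)))) •
        offShell (commute_endC β fun j => hw j.castSucc) (basisVec c) v s := by
  induction s using Finset.induction_on with
  | empty => simp [offShell_empty, component_basisVec]
  | insert i s hi ih =>
    rw [offShell_insert _ _ _ hi, component_zero_endC, component_one_endC, ih.1, ih.2,
      offShell_insert _ _ _ hi, Finset.prod_insert hi]
    simp [smul_smul]

end OffShellComponents

/-! ### Recursion and determinant formula for the scalar product. -/

section ScalarProduct

variable {M N : ℕ} (β : ℂ) {w : Fin M → ℂ} (hw : ∀ l, w l ≠ 0)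

include hw in
theorem vecMul_list_prod (l : List ℂ) (e : Config M → ℂ) :
    e ᵥ* (l.map (opC β w)).prod = (l.map (endC β w)).prod e := by
  induction l generalizing e with
  | nil => simp
  | cons x l ih =>
    -- Multiplying row vectors on the right applies the operators in reverse order; commutativity
    -- restores it.
    have hc : Commute (endC β w x) (l.map (endC β w)).prod :=
      Commute.list_prod_right _ _ fun y hy => by
        obtain ⟨t, -, rfl⟩ := List.mem_map.1 hy
        exact commute_endC β hw x t
    rw [List.map_cons, List.map_cons, List.prod_cons, List.prod_cons, ← Matrix.vecMul_vecMul, ih,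
      hc.eq]
    rfl

theorem mulVec_list_prod (l : List ℂ) (e : Config M → ℂ) :
    (l.map (opB β w)).prod *ᵥ e = (l.map (endB β w)).prod e := by
  induction l with
  | nil => simp
  | cons x l ih =>
    rw [List.map_cons, List.map_cons, List.prod_cons, List.prod_cons, ← Matrix.mulVec_mulVec, ih]
    rfl

theorem braFrom_eq_offShell (c : Config M) (u : Fin N → ℂ) :
    braFrom c β w u = offShell (commute_endC β hw) (basisVec c) u Finset.univ := by
  have := vecMul_list_prod β hw (List.ofFn u) (basisVec c)
  rw [List.map_ofFn, List.map_ofFn] at this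
  rw [offShell_univ_eq]
  exact this

theorem ketPsi_eq_offShell (v : Fin N → ℂ) :
    ketPsi β w v = offShell (commute_endB β hw) (basisVec fun _ => 0) v Finset.univ := by
  have := mulVec_list_prod β (w := w) (List.ofFn v) (basisVec fun _ => 0)
  rw [List.map_ofFn, List.map_ofFn] at this
  rw [offShell_univ_eq]
  exact this

theorem prod_univ_erase_eq_succAbove {R : Type*} [CommMonoid R] (F : Fin (N + 1) → R)
    (k : Fin (N + 1)) : ∏ i ∈ Finset.univ.erase k, F i = ∏ i, F (k.succAbove i) := by
  rw [Fin.univ_succAbove _ k, Finset.erase_cons, Finset.prod_map]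
  rfl

theorem scalarProduct_fin_zero (u v : Fin 0 → ℂ) : scalarProduct β w u v = 1 := by
  simp [scalarProduct, braPsi, braFrom, ketPsi, basisVec]

theorem scalarProduct_no_sites (w : Fin 0 → ℂ) (u v : Fin (N + 1) → ℂ) :
    scalarProduct β w u v = 0 := by
  simp [scalarProduct, ketPsi, opB, monodromy]

variable {v : Fin (N + 1) → ℂ} (hv : Function.Injective v)

include hv in
theorem component_one_ketPsi {w : Fin (M + 1) → ℂ} (hw : ∀ l, w l ≠ 0) :
    component 1 (ketPsi β w v) =
      ∑ k, (2 * (v k / w (Fin.last M)) * aFun β (fun j => w j.castSucc) (v k) *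
        ((∏ i : Fin N, v (k.succAbove i) / w (Fin.last M)) *
          ∏ i : Fin N, (v k + v (k.succAbove i)) / (v (k.succAbove i) - v k))) •
        ketPsi β (fun j => w j.castSucc) (fun i => v (k.succAbove i)) := by
  rw [ketPsi_eq_offShell β hw, (component_offShell_endB β hw hv.injOn).2]
  simp only [offShell_univ_erase, prod_univ_erase_eq_succAbove, Finset.prod_mul_distrib,
    ketPsi_eq_offShell β fun j => hw (Fin.castSucc j)]

include hv in
theorem scalarProduct_succ {w : Fin (M + 1) → ℂ} (hw : ∀ l, w l ≠ 0) {u : Fin (N + 1) → ℂ}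
    (hu : Function.Injective u) :
    scalarProduct β w u v =
      (∏ j, (1 - β * (u j / w (Fin.last M)))) * (∏ k, v k / w (Fin.last M)) *
        scalarProduct β (fun j => w j.castSucc) u v +
      ∑ j, ∑ k, (dFun (fun j => w j.castSucc) (u j) *
          ((∏ i : Fin N, (1 - β * (u (j.succAbove i) / w (Fin.last M)))) *
            ∏ i : Fin N, (u j + u (j.succAbove i)) / (u j - u (j.succAbove i)))) *
        (2 * (v k / w (Fin.last M)) * aFun β (fun j => w j.castSucc) (v k) *
        ((∏ i : Fin N, v (k.succAbove i) / w (Fin.last M)) *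
          ∏ i : Fin N, (v k + v (k.succAbove i)) / (v (k.succAbove i) - v k))) *
        scalarProduct β (fun j => w j.castSucc) (fun i => u (j.succAbove i))
          (fun i => v (k.succAbove i)) := by
  have hw' : ∀ j : Fin M, w j.castSucc ≠ 0 := fun j => hw j.castSucc
  rw [scalarProduct, dotProduct_eq_components, component_one_ketPsi β hv hw,
    ketPsi_eq_offShell β hw, (component_offShell_endB β hw hv.injOn).1, braPsi,
    braFrom_eq_offShell β hw, (component_offShell_endC β hw hu.injOn).1,
    (component_offShell_endC β hw hu.injOn).2]
  simp only [offShell_univ_erase, prod_univ_erase_eq_succAbove, Finset.prod_mul_distrib,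
    scalarProduct, braPsi, ketPsi_eq_offShell β hw', braFrom_eq_offShell β hw',
    sum_dotProduct, smul_dotProduct, dotProduct_smul, smul_eq_mul, one_mul]
  simp only [dotProduct_sum, dotProduct_smul, smul_eq_mul, Finset.mul_sum]
  congr 1
  · ring
  · exact Finset.sum_congr rfl fun j _ => Finset.sum_congr rfl fun k _ => by ring

end ScalarProduct

theorem neg_one_pow_add_mul (j k : ℕ) : (-1 : ℂ) ^ (j + k) * ((-1) ^ j * (-1) ^ k) = 1 := by
  rw [← pow_add, ← mul_pow]
  simp

theorem scalarProduct_eq_det {M N : ℕ} (β : ℂ) {w : Fin M → ℂ} (hw : ∀ l, w l ≠ 0)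
    {u v : Fin N → ℂ} (hu : Function.Injective u) (hv : Function.Injective v)
    (huv : ∀ j k, u j ≠ v k) :
    scalarProduct β w u v =
      pairProd (fun j k => (u j + u k) / (u j - u k)) *
      pairProd (fun j k => (v j + v k) / (v k - v j)) *
      (Matrix.of fun j k => 2 * v k *
        ((aFun β w (u j) * dFun w (v k) - dFun w (u j) * aFun β w (v k)) / (v k - u j))).det := by
  induction M generalizing N with
  | zero =>
    cases N with
    | zero => simp [scalarProduct_fin_zero, pairProd]
    | succ N =>
      -- With no sites `a = d = 1`, so every numerator vanishes.
      have : (Matrix.of fun j k => 2 * v k *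
          ((aFun β w (u j) * dFun w (v k) - dFun w (u j) * aFun β w (v k)) / (v k - u j))) = 0 := by
        ext j k
        simp [aFun, dFun]
      rw [scalarProduct_no_sites, this, Matrix.det_zero, mul_zero]
  | succ M ih =>
    cases N with
    | zero => simp [scalarProduct_fin_zero, pairProd]
    | succ N =>
      set z := w (Fin.last M) with hz
      have hz0 : z ≠ 0 := hw _
      set w' : Fin M → ℂ := fun j => w j.castSucc with hw'
      have hw0 : ∀ j, w' j ≠ 0 := fun j => hw _
      set G : Matrix (Fin (N + 1)) (Fin (N + 1)) ℂ := Matrix.of fun j k => 2 * v k *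
        ((aFun β w' (u j) * dFun w' (v k) - dFun w' (u j) * aFun β w' (v k)) / (v k - u j)) with hG
      -- Splitting off the factors of site 1, the remainder contains `(1 - β u / z) (v / z) - (u /
      -- z) (1 - β v / z) = (v - u) / z`. This cancels the pole `v - u` and leaves a product of a
      -- function of `u` and a function of `v`, that is, a rank-one matrix.
      have hmat : (Matrix.of fun j k => 2 * v k *
          ((aFun β w (u j) * dFun w (v k) - dFun w (u j) * aFun β w (v k)) / (v k - u j))) =
          Matrix.of fun j k =>
            (Matrix.of fun j k => (1 - β * (u j / z)) * (v k / z) * G j k) j k +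
              dFun w' (u j) * (2 * (v k / z) * aFun β w' (v k)) := by
        ext j k
        have h1 : v k - u j ≠ 0 := sub_ne_zero.2 (huv j k).symm
        have ha : ∀ x, aFun β w x = aFun β w' x * (1 - β * (x / z)) := fun x => by
          rw [aFun, Fin.prod_univ_castSucc, mul_div_assoc β x]
          rfl
        have hd : ∀ x, dFun w x = dFun w' x * (x / z) := fun x => by
          rw [dFun, Fin.prod_univ_castSucc]
          rfl
        simp only [Matrix.of_apply, ha, hd, hG]
        field_simp
        ring
      have hminor : ∀ j k : Fin (N + 1), scalarProduct β w' (fun i => u (j.succAbove i))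
          (fun i => v (k.succAbove i)) =
          pairProd (fun i l => (u (j.succAbove i) + u (j.succAbove l)) /
            (u (j.succAbove i) - u (j.succAbove l))) *
          pairProd (fun i l => (v (k.succAbove i) + v (k.succAbove l)) /
            (v (k.succAbove l) - v (k.succAbove i))) *
          (G.submatrix j.succAbove k.succAbove).det := fun j k =>
        ih hw0 (hu.comp Fin.succAbove_right_injective) (hv.comp Fin.succAbove_right_injective)
          fun _ _ => huv _ _
      have hsub : ∀ j k : Fin (N + 1),
          ((Matrix.of fun j k => (1 - β * (u j / z)) * (v k / z) * G j k).submatrix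
            j.succAbove k.succAbove).det =
          (∏ i, (1 - β * (u (j.succAbove i) / z))) * (∏ i, v (k.succAbove i) / z) *
            (G.submatrix j.succAbove k.succAbove).det := fun j k =>
        det_scale_rows_cols (G.submatrix j.succAbove k.succAbove) _ _
      rw [scalarProduct_succ β hv hw hu, ih hw0 hu hv huv, hmat, det_add_rank_one_fin_succ,
        det_scale_rows_cols, mul_add, Finset.mul_sum]
      congr 1
      · ring
      · refine Finset.sum_congr rfl fun j _ => ?_
        rw [Finset.mul_sum]
        refine Finset.sum_congr rfl fun k _ => ?_
        rw [hminor, hsub, pairProd_succAbove_of_antisymm (p := j) (fun i l => by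
            rw [← neg_sub, div_neg, add_comm]),
          pairProd_succAbove_of_antisymm (p := k) (F := fun i l => (v i + v l) / (v l - v i))
            (fun i l => by rw [← neg_sub, div_neg, add_comm])]
        -- Here `e` is the cofactor sign, and `a`, `b` are the signs from extracting `j` and `k`
        -- from the two pair products.
        have alg : ∀ e a b d q₁ f₁ c q₂ f₂ p₁ p₂ D : ℂ, e * (a * b) = 1 →
            d * (q₁ * f₁) * (c * (q₂ * f₂)) * (p₁ * p₂ * D) =
              a * f₁ * p₁ * (b * f₂ * p₂) * (e * (d * c) * (q₁ * q₂ * D)) := by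
          intro e a b d q₁ f₁ c q₂ f₂ p₁ p₂ D h
          linear_combination (-d * q₁ * f₁ * c * q₂ * f₂ * p₁ * p₂ * D) * h
        exact alg _ _ _ _ _ _ _ _ _ _ _ _ (neg_one_pow_add_mul j k)

/-! ### Recursion and determinant formula for intermediate scalar products. -/

/-- The rows of `intermediateMatrix`, as functions of the column variable. -/
noncomputable def intermediateRow {n m r : ℕ} (β : ℂ) (u : Fin n → ℂ) (w : Fin (r + m) → ℂ)
    (j : Fin (n + m)) (x : ℂ) : ℂ :=
  Fin.addCases
    (fun i : Fin n =>
      (∏ l : Fin m, (β * u i + w (Fin.natAdd r l)) / (β * u i - w (Fin.natAdd r l))) *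
        ((aFun β w (u i) * dFun w x - aFun β w x * dFun w (u i)) / (x - u i)))
    (fun i : Fin m =>
      1 / w (Fin.natAdd r i) *
        ∏ l ∈ Finset.univ.erase (Fin.natAdd r i), (1 - β * x / w l))
    j

theorem prod_univ_erase_last {M : ℕ} {R : Type*} [CommMonoid R] (F : Fin (M + 1) → R) :
    ∏ l ∈ Finset.univ.erase (Fin.last M), F l = ∏ l : Fin M, F l.castSucc := by
  simp only [prod_univ_erase_eq_succAbove, Fin.succAbove_last]

theorem prod_univ_erase_castSucc {M : ℕ} {R : Type*} [CommMonoid R] (F : Fin (M + 1) → R)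
    (i : Fin M) : ∏ l ∈ Finset.univ.erase i.castSucc, F l =
      (∏ l ∈ Finset.univ.erase i, F l.castSucc) * F (Fin.last M) := by
  have h : Finset.univ.erase i.castSucc =
      insert (Fin.last M) ((Finset.univ.erase i).map Fin.castSuccEmb) := by
    ext l
    refine Fin.lastCases ?_ (fun l => ?_) l
    · simp [(Fin.castSucc_lt_last i).ne']
    · simp [(Fin.castSucc_lt_last l).ne]
  rw [h, Finset.prod_insert (by simp [(Fin.castSucc_lt_last _).ne]), Finset.prod_map, mul_comm]
  rfl

theorem aFun_succ {M : ℕ} (β : ℂ) (w : Fin (M + 1) → ℂ) (x : ℂ) :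
    aFun β w x = aFun β (fun j => w j.castSucc) x * (1 - β * x / w (Fin.last M)) := by
  rw [aFun, Fin.prod_univ_castSucc]
  rfl

theorem dFun_succ {M : ℕ} (w : Fin (M + 1) → ℂ) (x : ℂ) :
    dFun w x = dFun (fun j => w j.castSucc) x * (x / w (Fin.last M)) := by
  rw [dFun, Fin.prod_univ_castSucc]
  rfl

section Rows

variable {n m r : ℕ} (β : ℂ) (u : Fin n → ℂ) (w : Fin (r + (m + 1)) → ℂ) (x : ℂ)

theorem intermediateRow_last : intermediateRow β u w (Fin.last (n + m)) x =
    1 / w (Fin.last (r + m)) * aFun β (fun j : Fin (r + m) => w j.castSucc) x := by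
  have h : Fin.last (n + m) = Fin.natAdd n (Fin.last m) := rfl
  have h' : Fin.natAdd r (Fin.last m) = Fin.last (r + m) := rfl
  rw [intermediateRow, h, Fin.addCases_right, h']
  exact congrArg (_ * ·) (prod_univ_erase_last (M := r + m) fun l => 1 - β * x / w l)

/-- With `z` the last inhomogeneity, the extra factor `(β u + z) / (β u - z)` turns the vacuum
weight `1 - β u / z` into `-(1 + β u / z)`, the weight of an occupied site up to sign. The pole-free
remainder, as in the scalar product case, is now a multiple of the last row. -/
theorem intermediateRow_castSucc_castAdd (hw : ∀ l, w l ≠ 0) (i : Fin n) (hx : x ≠ u i)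
    (hu : β * u i - w (Fin.last (r + m)) ≠ 0) :
    intermediateRow β u w (Fin.castSucc (Fin.castAdd m i)) x =
      -(1 + β * (u i / w (Fin.last (r + m)))) * (x / w (Fin.last (r + m))) *
        intermediateRow β u (fun j : Fin (r + m) => w j.castSucc) (Fin.castAdd m i) x +
      ((∏ l : Fin (m + 1), (β * u i + w (Fin.natAdd r l)) / (β * u i - w (Fin.natAdd r l))) *
        dFun (fun j : Fin (r + m) => w j.castSucc) (u i)) *
        intermediateRow β u w (Fin.last (n + m)) x := by
  have h : Fin.castSucc (Fin.castAdd m i) = Fin.castAdd (m + 1) i := rfl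
  have h' : ∀ l : Fin m, Fin.natAdd r (Fin.castSucc l) = Fin.castSucc (Fin.natAdd r l) :=
    fun _ => rfl
  have h'' : Fin.natAdd r (Fin.last m) = Fin.last (r + m) := rfl
  have hz := hw (Fin.last (r + m))
  have hxu : x - u i ≠ 0 := sub_ne_zero.2 hx
  rw [intermediateRow_last, intermediateRow, intermediateRow, h, Fin.addCases_left,
    Fin.addCases_left, Fin.prod_univ_castSucc]
  simp only [h', h'']
  have e := fun y => aFun_succ (M := r + m) β w y
  have e' := fun y => dFun_succ (M := r + m) w y
  rw [e, e, e', e']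
  generalize ∏ l : Fin m, (β * u i + w (Fin.natAdd r l).castSucc) /
    (β * u i - w (Fin.natAdd r l).castSucc) = P
  field_simp
  ring

/-- The multiple of the last row is chosen to cancel the value at `x = 0`, so a factor `x` splits
off. The remaining scale contains `β (1 - z / w_i)`, with `z` the last inhomogeneity, and this
cancels the prefactor of the pair formed by `i` and the last index. -/
theorem intermediateRow_castSucc_natAdd (hw : ∀ l, w l ≠ 0) (i : Fin m) :
    intermediateRow β u w (Fin.castSucc (Fin.natAdd n i)) x =
      -(β * (1 - w (Fin.last (r + m)) / w (Fin.castSucc (Fin.natAdd r i)))) *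
        (x / w (Fin.last (r + m))) *
        intermediateRow β u (fun j : Fin (r + m) => w j.castSucc) (Fin.natAdd n i) x +
      (w (Fin.last (r + m)) / w (Fin.castSucc (Fin.natAdd r i))) *
        intermediateRow β u w (Fin.last (n + m)) x := by
  have h : Fin.castSucc (Fin.natAdd n i) = Fin.natAdd n (Fin.castSucc i) := rfl
  have h' : Fin.natAdd r (Fin.castSucc i) = Fin.castSucc (Fin.natAdd r i) := rfl
  have hz := hw (Fin.last (r + m))
  have hi := hw (Fin.castSucc (Fin.natAdd r i))
  rw [intermediateRow_last, intermediateRow, intermediateRow, h, Fin.addCases_right,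
    Fin.addCases_right, h', aFun, ← Finset.mul_prod_erase _ _ (Finset.mem_univ (Fin.natAdd r i))]
  refine (congrArg (_ * ·) (prod_univ_erase_castSucc (M := r + m) (fun l => 1 - β * x / w l)
    (Fin.natAdd r i))).trans ?_
  generalize (∏ l ∈ Finset.univ.erase (Fin.natAdd r i), (1 - β * x / w l.castSucc)) = P
  field_simp
  ring

end Rows

/-- The ones of the bra fill the first `m + 1` sites, which carry the last `m + 1` inhomogeneities
in reversed order; removing site 1 therefore shortens both blocks consistently. -/
theorem intermediate_succ {n m r : ℕ} (β : ℂ) (u : Fin n → ℂ) {v : Fin (n + m + 1) → ℂ}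
    {w : Fin (r + m + 1) → ℂ} (hw : ∀ l, w l ≠ 0) (hv : Function.Injective v) :
    intermediate (m := m + 1) (r := r) β u v w =
      ∑ k, (∏ j, (1 + β * (u j / w (Fin.last (r + m))))) *
        (2 * (v k / w (Fin.last (r + m))) * aFun β (fun j => w j.castSucc) (v k) *
        ((∏ i : Fin (n + m), v (k.succAbove i) / w (Fin.last (r + m))) *
          ∏ i : Fin (n + m), (v k + v (k.succAbove i)) / (v (k.succAbove i) - v k))) *
        intermediate (m := m) (r := r) β u (fun i => v (k.succAbove i)) fun j => w j.castSucc := by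
  have hc : (fun i : Fin (r + m + 1) => if i.val < m + 1 then (1 : Fin 2) else 0) =
      Fin.cons 1 fun i : Fin (r + m) => if i.val < m then 1 else 0 := by
    funext i
    refine Fin.cases ?_ (fun i => ?_) i <;> simp
  have h1 := component_offShell_endC_of_one β hw (v := u)
    (fun i : Fin (r + m) => if i.val < m then 1 else 0) Finset.univ
  have h2 : intermediate (m := m + 1) (r := r) β u v w =
      braFrom (fun i : Fin (r + m + 1) => if i.val < m + 1 then (1 : Fin 2) else 0) β w u ⬝ᵥ
        ketPsi β w v := rfl
  rw [h2, dotProduct_eq_components, component_one_ketPsi β hv hw, hc, braFrom_eq_offShell β hw,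
    h1.1, h1.2, zero_dotProduct, zero_add, dotProduct_sum]
  simp only [intermediate, braFrom_eq_offShell β fun j => hw (Fin.castSucc j), smul_dotProduct,
    dotProduct_smul, smul_eq_mul]
  exact Finset.sum_congr rfl fun k _ => by ring

theorem intermediate_eq_det {n m r : ℕ} (β : ℂ) {u : Fin n → ℂ} {v : Fin (n + m) → ℂ}
    {w : Fin (r + m) → ℂ} (hw : ∀ l, w l ≠ 0) (hu : Function.Injective u)
    (hv : Function.Injective v) (huv : ∀ j k, u j ≠ v k)
    (huw : ∀ j (l : Fin m), β * u j - w (Fin.natAdd r l) ≠ 0)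
    (hβ : ∀ j k : Fin m, j < k → β ≠ 0 ∧ w (Fin.natAdd r j) ≠ w (Fin.natAdd r k)) :
    intermediate β u v w =
      pairProd (fun j k => (v j + v k) / (v k - v j)) *
      pairProd (fun j k : Fin m =>
        1 / (β * (1 - w (Fin.natAdd r k) / w (Fin.natAdd r j)))) *
      pairProd (fun j k => (u j + u k) / (u j - u k)) *
      (Matrix.of fun j k => 2 * v k * intermediateRow β u w j (v k)).det := by
  induction m with
  | zero =>
    have h := scalarProduct_eq_det (M := r) (N := n) β (w := w) hw hu hv huv
    have hW : pairProd (fun j k : Fin 0 =>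
        1 / (β * (1 - w (Fin.natAdd r k) / w (Fin.natAdd r j)))) = 1 := by simp [pairProd]
    have hm : (Matrix.of fun j k => 2 * v k * intermediateRow β u w j (v k)) =
        (Matrix.of fun j k : Fin n => 2 * v k * ((aFun (M := r) β w (u j) * dFun (M := r) w (v k) -
          dFun (M := r) w (u j) * aFun (M := r) β w (v k)) / (v k - u j))) := by
      ext j k
      change 2 * v k * intermediateRow β u w (Fin.castAdd 0 j) (v k) = _
      rw [intermediateRow, Fin.addCases_left, Finset.univ_eq_empty, Finset.prod_empty, one_mul,
        mul_comm (aFun β w (v k))]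
      rfl
    have hS : intermediate β u v w = scalarProduct (M := r) (N := n) β w u v := by
      simp [intermediate, scalarProduct, braPsi]
    rw [hS, h, hW, hm]
    change _ = pairProd (N := n) (fun j k => (v j + v k) / (v k - v j)) * 1 * _ * _
    ring
  | succ m ih =>
    have hw' : ∀ j : Fin (r + m), w (Fin.castSucc j) ≠ 0 := fun j => hw _
    have hz0 : w (Fin.last (r + m)) ≠ 0 := hw _
    have hul : ∀ i, β * u i - w (Fin.last (r + m)) ≠ 0 := fun i => huw i (Fin.last m)
    set s : Fin (n + m) → ℂ := fun j => Fin.addCases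
      (fun i : Fin n => -(1 + β * (u i / w (Fin.last (r + m)))))
      (fun i : Fin m => -(β * (1 - w (Fin.last (r + m)) / w (Fin.castSucc (Fin.natAdd r i))))) j
      with hs
    set c : Fin (n + m) → ℂ := fun j => Fin.addCases
      (fun i : Fin n => (∏ l : Fin (m + 1), (β * u i + w (Fin.natAdd r l)) /
        (β * u i - w (Fin.natAdd r l))) * dFun (fun j : Fin (r + m) => w j.castSucc) (u i))
      (fun i : Fin m => w (Fin.last (r + m)) / w (Fin.castSucc (Fin.natAdd r i))) j with hc
    set row : Fin (n + m) → ℂ → ℂ :=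
      intermediateRow β u (fun j : Fin (r + m) => w j.castSucc) with hrow
    have hrows : ∀ (j : Fin (n + m)) (k : Fin (n + m + 1)),
        intermediateRow β u w (Fin.castSucc j) (v k) =
          s j * (v k / w (Fin.last (r + m))) * row j (v k) +
            c j * intermediateRow β u w (Fin.last (n + m)) (v k) := by
      intro j k
      refine Fin.addCases (fun i => ?_) (fun i => ?_) j
      · simp only [hs, hc, Fin.addCases_left]
        exact intermediateRow_castSucc_castAdd β u w _ hw i (huv i k).symm (hul i)
      · simp only [hs, hc, Fin.addCases_right]
        exact intermediateRow_castSucc_natAdd β u w _ hw i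
    -- `B` is the matrix after multiples `c j` of the last row have been subtracted from the others.
    -- Its upper rows are rescaled rows of the smaller problem, evaluated at all the `v k`.
    let B : Matrix (Fin (n + m + 1)) (Fin (n + m + 1)) ℂ := Matrix.of fun j k =>
      Fin.lastCases (motive := fun _ => ℂ)
        (2 * v k * intermediateRow β u w (Fin.last (n + m)) (v k))
        (fun j => s j * (v k / w (Fin.last (r + m))) * (2 * v k * row j (v k))) j
    have hBl : ∀ k, B (Fin.last _) k =
        2 * v k * intermediateRow β u w (Fin.last (n + m)) (v k) := fun k => by
      simp only [B, Matrix.of_apply, Fin.lastCases_last]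
    have hBc : ∀ j k, B (Fin.castSucc j) k =
        s j * (v k / w (Fin.last (r + m))) * (2 * v k * row j (v k)) := fun j k => by
      simp only [B, Matrix.of_apply, Fin.lastCases_castSucc]
    have hdet : (Matrix.of fun j k : Fin (n + m + 1) =>
        2 * v k * intermediateRow β u w j (v k)).det = B.det := by
      refine Matrix.det_eq_of_forall_row_eq_smul_add_const
        (Fin.lastCases (motive := fun _ => ℂ) 0 c) (Fin.last _) (by simp) fun j k => ?_
      refine Fin.lastCases ?_ (fun j => ?_) j
      · simp [hBl]
      · rw [hBl, hBc, Fin.lastCases_castSucc, Matrix.of_apply, hrows]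
        ring
    have hminor : ∀ k : Fin (n + m + 1),
        (B.submatrix (Fin.last (n + m)).succAbove k.succAbove).det =
          (∏ j, s j) * (∏ i : Fin (n + m), v (k.succAbove i) / w (Fin.last (r + m))) *
            (Matrix.of fun j i => 2 * v (k.succAbove i) * row j (v (k.succAbove i))).det := by
      intro k
      rw [← det_scale_rows_cols]
      congr 1
      ext j i
      rw [Matrix.submatrix_apply, Fin.succAbove_last, hBc]
      rfl
    have hprod : (∏ j, s j) = (-1) ^ (n + m) *
        ((∏ j, (1 + β * (u j / w (Fin.last (r + m))))) *
          ∏ i : Fin m, β * (1 - w (Fin.last (r + m)) / w (Fin.castSucc (Fin.natAdd r i)))) := by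
      simp only [Fin.prod_univ_add, hs, Fin.addCases_left, Fin.addCases_right, Finset.prod_neg,
        Finset.card_univ, Fintype.card_fin, pow_add]
      ring
    -- The scales of the lower block cancel exactly the pairs that contain the last index, which is
    -- where `β ≠ 0` and distinctness of the `w` enter.
    have hW : pairProd (fun j k : Fin (m + 1) =>
          1 / (β * (1 - w (Fin.natAdd r k) / w (Fin.natAdd r j)))) *
        ∏ i : Fin m, β * (1 - w (Fin.last (r + m)) / w (Fin.castSucc (Fin.natAdd r i))) =
        pairProd (fun j k : Fin m => 1 / (β * (1 - w (Fin.castSucc (Fin.natAdd r k)) /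
          w (Fin.castSucc (Fin.natAdd r j))))) := by
      rw [pairProd_succAbove _ (Fin.last m), mul_right_comm, ← Finset.prod_mul_distrib]
      rw [Finset.prod_eq_one, one_mul]
      · simp only [Fin.succAbove_last]
        rfl
      · intro i _
        obtain ⟨h1, h2⟩ := hβ i.castSucc (Fin.last m) (Fin.castSucc_lt_last i)
        have h3 : w (Fin.natAdd r i.castSucc) - w (Fin.natAdd r (Fin.last m)) ≠ 0 :=
          sub_ne_zero.2 h2
        have h4 : w (Fin.natAdd r i.castSucc) ≠ 0 := hw _
        rw [Fin.succAbove_last, if_neg (Fin.castSucc_lt_last i).not_gt]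
        change 1 / (β * (1 - w (Fin.natAdd r (Fin.last m)) / w (Fin.natAdd r i.castSucc))) *
          (β * (1 - w (Fin.natAdd r (Fin.last m)) / w (Fin.natAdd r i.castSucc))) = 1
        refine one_div_mul_cancel (mul_ne_zero h1 ?_)
        rw [one_sub_div h4]
        exact div_ne_zero h3 h4
    have hih : ∀ k : Fin (n + m + 1),
        intermediate (m := m) (r := r) β u (fun i => v (k.succAbove i)) (fun j => w j.castSucc) =
          pairProd (fun i l => (v (k.succAbove i) + v (k.succAbove l)) /
            (v (k.succAbove l) - v (k.succAbove i))) *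
          pairProd (fun j k : Fin m => 1 / (β * (1 - w (Fin.castSucc (Fin.natAdd r k)) /
            w (Fin.castSucc (Fin.natAdd r j))))) *
          pairProd (fun j k => (u j + u k) / (u j - u k)) *
          (Matrix.of fun j i => 2 * v (k.succAbove i) * row j (v (k.succAbove i))).det := fun k =>
      ih hw' (hv.comp Fin.succAbove_right_injective) (fun _ _ => huv _ _)
        (fun j l => huw j l.castSucc) fun j l hjl => hβ j.castSucc l.castSucc hjl
    have hV : ∀ k : Fin (n + m + 1), pairProd (fun j k => (v j + v k) / (v k - v j)) =
        (-1) ^ (k : ℕ) *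
          (∏ i : Fin (n + m), (v k + v (k.succAbove i)) / (v (k.succAbove i) - v k)) *
          pairProd (fun i l => (v (k.succAbove i) + v (k.succAbove l)) /
            (v (k.succAbove l) - v (k.succAbove i))) := fun k =>
      pairProd_succAbove_of_antisymm (p := k) (F := fun i l => (v i + v l) / (v l - v i))
        (fun i l => by rw [← neg_sub, div_neg, add_comm])
    rw [intermediate_succ β u hw hv]
    refine Eq.trans ?_ (congrArg (_ * ·) hdet.symm)
    rw [Matrix.det_succ_row B (Fin.last (n + m)), Finset.mul_sum]
    refine Finset.sum_congr rfl fun k _ => ?_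
    rw [hih, hminor, hprod, hBl, intermediateRow_last, hV k, ← hW, Fin.val_last]
    -- Here `e` is the Laplace sign along the last row, `a = (-1) ^ k` comes from the pair product
    -- in `v`, and `b = (-1) ^ (n + m)` from the row scales.
    have alg : ∀ e a b A c q f p W β' U D : ℂ, e * (a * b) = 1 →
        A * (c * (q * f)) * (p * (W * β') * U * D) =
          a * f * p * W * U * (e * c * (b * (A * β') * q * D)) := by
      intro e a b A c q f p W β' U D h
      linear_combination (-A * c * q * f * p * W * β' * U * D) * h
    refine Eq.trans (alg _ _ _ _ _ _ _ _ _ _ _ _ ((congrArg (_ * ·) (mul_comm _ _)).trans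
      (neg_one_pow_add_mul (n + m) k))) ?_
    have hc' : 2 * (v k / w (Fin.last (r + m))) *
        aFun β (fun j : Fin (r + m) => w j.castSucc) (v k) =
        2 * v k * (1 / w (Fin.last (r + m)) *
          aFun β (fun j : Fin (r + m) => w j.castSucc) (v k)) := by ring
    rw [hc']

/-! ### Continuity and passage to exceptional parameters. -/

theorem continuousAt_list_prod_ofFn {X : Type*} [TopologicalSpace X] {x₀ : X} {M N : ℕ}
    {F : Fin N → X → QOp M} (hF : ∀ k, ContinuousAt (F k) x₀) :
    ContinuousAt (fun x => (List.ofFn fun k => F k x).prod) x₀ := by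
  induction N with
  | zero => simpa using continuousAt_const
  | succ N ih =>
    simp only [List.ofFn_succ, List.prod_cons]
    exact (hF 0).mul (ih fun k => hF k.succ)

theorem continuousAt_braFrom_dotProduct_ketPsi {X : Type*} [TopologicalSpace X] {x₀ : X}
    {M n N : ℕ} (c : Config M) {β : X → ℂ} {w : X → Fin M → ℂ} {u : X → Fin n → ℂ}
    {v : X → Fin N → ℂ} (hβ : ContinuousAt β x₀) (hw : ContinuousAt w x₀)
    (hu : ContinuousAt u x₀) (hv : ContinuousAt v x₀) (hw0 : ∀ l, w x₀ l ≠ 0) :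
    ContinuousAt (fun x => braFrom c (β x) (w x) (u x) ⬝ᵥ ketPsi (β x) (w x) (v x)) x₀ := by
  have hB := continuousAt_list_prod_ofFn (F := fun k x => opB (β x) (w x) (v x k)) fun k =>
    continuousAt_monodromy hβ hw (continuousAt_pi.1 hv k) hw0 0 1
  have hC := continuousAt_list_prod_ofFn (F := fun k x => opC (β x) (w x) (u x k)) fun k =>
    continuousAt_monodromy hβ hw (continuousAt_pi.1 hu k) hw0 1 0
  have key : ∀ (P Q : X → QOp M), ContinuousAt P x₀ → ContinuousAt Q x₀ →
      ContinuousAt (fun x => (basisVec c ᵥ* P x) ⬝ᵥ (Q x *ᵥ basisVec fun _ => 0)) x₀ := by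
    intro P Q hP hQ
    have hc : Continuous fun p : QOp M × QOp M =>
        (basisVec c ᵥ* p.1) ⬝ᵥ (p.2 *ᵥ basisVec fun _ => 0) :=
      (continuous_const.matrix_vecMul continuous_fst).dotProduct
        (continuous_snd.matrix_mulVec continuous_const)
    exact ContinuousAt.comp (f := fun x => (P x, Q x)) hc.continuousAt (hP.prodMk hQ)
  exact key _ _ hC hB

theorem scalarProduct_eq_detFormula {M N : ℕ} (β : ℂ) {w : Fin M → ℂ} (hw : ∀ l, w l ≠ 0)
    {u v : Fin N → ℂ} (h : (u, v) ∈ genericUV N) :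
    scalarProduct β w u v = detFormula (aFun β w) (dFun w) u v := by
  obtain ⟨hu, hv, huv⟩ := h
  rw [scalarProduct_eq_det β hw hu hv huv, detFormula]
  have := Matrix.det_mul_row (fun k => 2 * v k) (Matrix.of fun j k : Fin N =>
    (aFun β w (u j) * dFun w (v k) - dFun w (u j) * aFun β w (v k)) / (v k - u j))
  simp only [Matrix.of_apply] at this
  rw [this, ← mul_assoc, mul_comm (∏ j, 2 * v j)]
  congr 2
  simp only [pairProd, ← Finset.prod_mul_distrib, div_mul_div_comm]

theorem tendsto_detFormula {M N : ℕ} (β : ℂ) {w : Fin M → ℂ} (hw : ∀ l, w l ≠ 0)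
    (u v : Fin N → ℂ) :
    Tendsto (fun p : (Fin N → ℂ) × (Fin N → ℂ) => detFormula (aFun β w) (dFun w) p.1 p.2)
      (𝓝[genericUV N] (u, v)) (𝓝 (scalarProduct β w u v)) := by
  have hc : ContinuousAt (fun p : (Fin N → ℂ) × (Fin N → ℂ) => scalarProduct β w p.1 p.2) (u, v) :=
    continuousAt_braFrom_dotProduct_ketPsi (w := fun _ => w) (u := Prod.fst) (v := Prod.snd) _
      continuousAt_const continuousAt_const continuousAt_fst continuousAt_snd hw
  -- On the generic set the formula coincides with the scalar product, so its limit is the value of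
  -- that continuous function.
  refine (hc.tendsto.mono_left nhdsWithin_le_nhds).congr' ?_
  filter_upwards [self_mem_nhdsWithin] with p hp
  exact scalarProduct_eq_detFormula β hw hp

theorem intermediate_eq_intermediateFormula {n m r : ℕ} {β : ℂ} {u : Fin n → ℂ}
    {v : Fin (n + m) → ℂ} {w : Fin (r + m) → ℂ} (h : (β, u, v, w) ∈ genericAll n m r) :
    intermediate β u v w = intermediateFormula β u v w := by
  obtain ⟨hu, hv, huv, hw, huw, hβ⟩ := h
  rw [intermediate_eq_det β hw hu hv huv huw hβ, intermediateFormula]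
  have : (Matrix.of fun j k => 2 * v k * intermediateRow β u w j (v k)).det =
      (∏ k, 2 * v k) * (intermediateMatrix β u v w).det :=
    Matrix.det_mul_row (fun k => 2 * v k) (intermediateMatrix β u v w)
  rw [this]
  simp only [pairProd]
  ring

theorem tendsto_intermediateFormula {n m r : ℕ} (β : ℂ) (u : Fin n → ℂ) (v : Fin (n + m) → ℂ)
    {w : Fin (r + m) → ℂ} (hw : ∀ l, w l ≠ 0) :
    Tendsto (fun p : ℂ × (Fin n → ℂ) × (Fin (n + m) → ℂ) × (Fin (r + m) → ℂ) =>
        intermediateFormula p.1 p.2.1 p.2.2.1 p.2.2.2)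
      (𝓝[genericAll n m r] (β, u, v, w)) (𝓝 (intermediate β u v w)) := by
  have hc : ContinuousAt (fun p : ℂ × (Fin n → ℂ) × (Fin (n + m) → ℂ) × (Fin (r + m) → ℂ) =>
      intermediate p.1 p.2.1 p.2.2.1 p.2.2.2) (β, u, v, w) := by
    simp only [intermediate]
    exact continuousAt_braFrom_dotProduct_ketPsi (X := ℂ × (Fin n → ℂ) × (Fin (n + m) → ℂ) ×
      (Fin (r + m) → ℂ)) (β := fun p => p.1) (w := fun p => p.2.2.2)
      (u := fun p => p.2.1) (v := fun p => p.2.2.1) _ (by fun_prop) (by fun_prop) (by fun_prop)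
      (by fun_prop) hw
  refine (hc.tendsto.mono_left nhdsWithin_le_nhds).congr' ?_
  filter_upwards [self_mem_nhdsWithin] with p hp
  exact intermediate_eq_intermediateFormula hp

theorem aFun_one (M : ℕ) (β : ℂ) : aFun β (fun _ : Fin M => 1) = fun x => (1 - β * x) ^ M := by
  funext x
  simp [aFun]

theorem dFun_one (M : ℕ) : dFun (fun _ : Fin M => 1) = fun x => x ^ M := by
  funext x
  simp [dFun]

end SixVertex

theorem mainTheorem3 :
    -- homogeneous scalar product: generic points, then all points as a limit
    (∀ (M N : ℕ) (β : ℂ) (u v : Fin N → ℂ),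
      ((u, v) ∈ SixVertex.genericUV N →
        SixVertex.scalarProduct β (fun _ : Fin M => 1) u v =
          SixVertex.detFormula (fun x => (1 - β * x) ^ M) (fun x => x ^ M) u v) ∧
      Tendsto (fun p : (Fin N → ℂ) × (Fin N → ℂ) =>
          SixVertex.detFormula (fun x => (1 - β * x) ^ M) (fun x => x ^ M) p.1 p.2)
        (𝓝[SixVertex.genericUV N] (u, v))
        (𝓝 (SixVertex.scalarProduct β (fun _ : Fin M => 1) u v))) ∧
    -- inhomogeneous scalar product
    (∀ (M N : ℕ) (β : ℂ) (w : Fin M → ℂ), (∀ l, w l ≠ 0) → ∀ u v : Fin N → ℂ,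
      ((u, v) ∈ SixVertex.genericUV N →
        SixVertex.scalarProduct β w u v =
          SixVertex.detFormula (SixVertex.aFun β w) (SixVertex.dFun w) u v) ∧
      Tendsto (fun p : (Fin N → ℂ) × (Fin N → ℂ) =>
          SixVertex.detFormula (SixVertex.aFun β w) (SixVertex.dFun w) p.1 p.2)
        (𝓝[SixVertex.genericUV N] (u, v))
        (𝓝 (SixVertex.scalarProduct β w u v))) ∧
    -- intermediate scalar products, with `N = n + m` and `M = r + m`
    (∀ (n m r : ℕ) (β : ℂ) (u : Fin n → ℂ) (v : Fin (n + m) → ℂ) (w : Fin (r + m) → ℂ),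
      (∀ l, w l ≠ 0) →
      ((β, u, v, w) ∈ SixVertex.genericAll n m r →
        SixVertex.intermediate β u v w = SixVertex.intermediateFormula β u v w) ∧
      Tendsto (fun p : ℂ × (Fin n → ℂ) × (Fin (n + m) → ℂ) × (Fin (r + m) → ℂ) =>
          SixVertex.intermediateFormula p.1 p.2.1 p.2.2.1 p.2.2.2)
        (𝓝[SixVertex.genericAll n m r] (β, u, v, w))
        (𝓝 (SixVertex.intermediate β u v w))) := by
  refine ⟨fun M N β u v => ?_, fun M N β w hw u v => ?_, fun n m r β u v w hw => ?_⟩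
  · rw [← SixVertex.aFun_one, ← SixVertex.dFun_one]
    exact ⟨SixVertex.scalarProduct_eq_detFormula β fun _ => one_ne_zero,
      SixVertex.tendsto_detFormula β (fun _ => one_ne_zero) u v⟩
  · exact ⟨SixVertex.scalarProduct_eq_detFormula β hw, SixVertex.tendsto_detFormula β hw u v⟩
  · exact ⟨SixVertex.intermediate_eq_intermediateFormula,
      SixVertex.tendsto_intermediateFormula β u v hw⟩
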